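/- \textbf{Model.} Let $d\in\mathbb N=\{1,2,\dots\}$ and let $\nu$ be a fixed probability measure on $\mathbb R^d$ with $\int|x|\,\nu(dx)<\infty$. For a measurable $m:\mathbb R^d\to\mathbb R$ consider the nonlinear AR($d$) model $$Y_t=m(X_t)+v_t,\quad X_t=(Y_{t-1},\dots,Y_{t-d}),\quad t=1,\dots,T,\qquad X_1=(Y_0,\dots,Y_{-d+1})\sim\nu,\qquad v_t\overset{\text{i.i.d.}}{\sim}N(0,1),$$ with $(v_t)$ independent of $X_1$. Put $f_0=m\mathbf 1_{[0,1]^d}$. An estimator $\hat f_T$ is a real-valued random function on $\mathbb R^d$ that is jointly measurable in the data $\{(Y_t,X_t)\}_{t=1}^T$ and the point of $\mathbb R^d$ (it need not be bounded), and its risk is $$R(\hat f_T,f_0)=\mathrm E\Big[\frac1T\sum_{t=1}^T\big(\hat f_T(X_t^*)-f_0(X_t^*)\big)^2\Big]\in[0,\infty],$$ where $(X_t^*)_{t=1}^T$ is an independent copy of $(X_t)_{t=1}^T$. \textbf{Class of mean functions.} For $p,r\in\mathbb N$, $r\le p$, $\beta,A>0$ and $l<u$, let $C_r^\beta([l,u]^p,A)$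 be the set of functions $f:[l,u]^p\to\mathbb R$ that depend on at most $r$ coordinates, are of class $C^{\lfloor\beta\rfloor}$, and satisfy $$\sum_{|\alpha|_1<\beta}\sup_{[l,u]^p}|\partial^\alpha f|+\sum_{|\alpha|_1=\lfloor\beta\rfloor}\ \sup_{x\ne y\in[l,u]^p}\frac{|\partial^\alpha f(x)-\partial^\alpha f(y)|}{|x-y|_\infty^{\beta-\lfloor\beta\rfloor}}\le A .$$ Let $q\ge0$ be an integer, $\mathbf d=(d_0,\dots,d_{q+1})\in\mathbb N^{q+2}$ with $d_0=d$ and $d_{q+1}=1$, $\mathbf t=(t_0,\dots,t_q)\in\mathbb N^{q+1}$ with $t_i\le d_i$ for all $i$, and $\boldsymbol\beta=(\beta_0,\dots,\beta_q)\in(0,\infty)^{q+1}$. Let $\mathcal G(q,\mathbf d,\mathbf t,\boldsymbol\beta,A)$ be the set of functions $f=g_q\circ\cdots\circ g_0$ on $[0,1]^d$ with $g_i=(g_{ij})_j:[l_i,u_i]^{d_i}\to[l_{i+1},u_{i+1}]^{d_{i+1}}$ and $g_{ij}\in C_{t_i}^{\beta_i}([l_i,u_i]^{d_i},A)$, where $l_0=0$,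 $u_0=1$, $l_i<u_i$, and $|l_{i+1}|,|u_{i+1}|\le A$ for $i=0,\dots,q$. For $\mathbf c=(c_0,\dots,c_d)\in(0,\infty)^{d+1}$ with $\sum_{i=1}^dc_i<1$, let $\mathcal M(\mathbf c,q,\mathbf d,\mathbf t,\boldsymbol\beta,A)$ be the set of measurable $m:\mathbb R^d\to\mathbb R$ with $|m(x)|\le c_0+\sum_{i=1}^dc_i|x_i|$ for all $x\in\mathbb R^d$ and $m|_{[0,1]^d}\in\mathcal G(q,\mathbf d,\mathbf t,\boldsymbol\beta,A)$. Finally put $$\beta_i^*=\beta_i\prod_{\ell=i+1}^q\min(\beta_\ell,1),\qquad \phi_T=\max_{i=0,\dots,q}T^{-\frac{2\beta_i^*}{2\beta_i^*+t_i}} .$$ \textbf{Theorem.} Suppose that $t_j\le\min\{d_0,\dots,d_{j-1}\}$ for all $1\le j\le q$. Then there is a constant $A_0>0$, depending only on $q,\mathbf d,\mathbf t,\boldsymbol\beta$, such that for every $A\ge A_0$, every $\mathbf c$ as above with $c_0\ge A$, and every $\nu$ as above, $$\liminf_{T\to\infty}\ \phi_T^{-1}\,\inf_{\hat f_T}\ \sup_{m\in\mathcal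 M(\mathbf c,q,\mathbf d,\mathbf t,\boldsymbol\beta,A)}R(\hat f_T,f_0)>0,$$ where the infimum is over all estimators $\hat f_T$. -/

import Mathlib

open MeasureTheory ProbabilityTheory Filter
open scoped ENNReal

noncomputable section

namespace NonlinearAR

/-! ### Hölder classes and compositions -/

/-- The cube `[l, u]^p`. -/
def cube (p : ℕ) (l u : ℝ) : Set (Fin p → ℝ) :=
  Set.Icc (fun _ => l) (fun _ => u)

/-- The partial derivative `∂^α f (x)` on the set `s`: the derivative of order `|α|₁` of `f`
applied to the family of coordinate vectors in which `e_i` occurs exactly `α i` times. -/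
def multiDeriv {p : ℕ} (s : Set (Fin p → ℝ)) (α : Fin p → ℕ) (f : (Fin p → ℝ) → ℝ)
    (x : Fin p → ℝ) : ℝ :=
  iteratedFDerivWithin ℝ (∑ i, α i) f s x
    (fun j => Pi.single (finSigmaFinEquiv.symm j).1 (1 : ℝ))

/-- The multi-indices `α` with `|α|₁ = k`. -/
def multiIndices (p k : ℕ) : Finset (Fin p → ℕ) :=
  Finset.piAntidiag Finset.univ k

/-- The Hölder norm of order `β` on `[l, u]^p`, with values in `[0, ∞]`. For a natural number `k`,
`k < β` is the same as `k ∈ range ⌈β⌉₊`; `edist` on `Fin p → ℝ` is the sup-distance. -/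
def holderNorm (p : ℕ) (l u β : ℝ) (f : (Fin p → ℝ) → ℝ) : ℝ≥0∞ :=
  (∑ k ∈ Finset.range ⌈β⌉₊, ∑ α ∈ multiIndices p k,
      ⨆ x ∈ cube p l u, ‖multiDeriv (cube p l u) α f x‖ₑ) +
    ∑ α ∈ multiIndices p ⌊β⌋₊,
      ⨆ (x ∈ cube p l u) (y ∈ cube p l u) (_ : x ≠ y),
        ‖multiDeriv (cube p l u) α f x - multiDeriv (cube p l u) α f y‖ₑ /
          edist x y ^ (β - (⌊β⌋₊ : ℝ))

/-- `f` depends, on `[l, u]^p`, on at most `r` coordinates. -/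
def DependsOnAtMost (p r : ℕ) (l u : ℝ) (f : (Fin p → ℝ) → ℝ) : Prop :=
  ∃ s : Finset (Fin p), s.card ≤ r ∧
    ∀ x ∈ cube p l u, ∀ y ∈ cube p l u, (∀ i ∈ s, x i = y i) → f x = f y

/-- The class `C_r^β([l, u]^p, A)`; only the values of `f` on the cube matter. -/
def holderClass (p r : ℕ) (l u β A : ℝ) : Set ((Fin p → ℝ) → ℝ) :=
  {f | DependsOnAtMost p r l u f ∧
    ContDiffOn ℝ (⌊β⌋₊ : ℕ) f (cube p l u) ∧
    holderNorm p l u β f ≤ ENNReal.ofReal A}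

/-- The partial compositions `g_{k-1} ∘ ⋯ ∘ g_0`, for `k = 0, …, q + 1`. -/
def composite {q : ℕ} {d : Fin (q + 2) → ℕ}
    (g : ∀ i : Fin (q + 1), (Fin (d i.castSucc) → ℝ) → (Fin (d i.succ) → ℝ)) :
    ∀ k : Fin (q + 2), (Fin (d 0) → ℝ) → (Fin (d k) → ℝ) :=
  Fin.induction id (fun i h => g i ∘ h)

/-- The functions whose restriction to `[0, 1]^{d_0}` is in the composition class
`𝒢(q, d, t, β, A)`. It is used for `d_{q+1} = 1`, where `composite g (Fin.last _) x` has exactly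
one coordinate. -/
def compositionClass (q : ℕ) (d : Fin (q + 2) → ℕ) (t : Fin (q + 1) → ℕ)
    (β : Fin (q + 1) → ℝ) (A : ℝ) : Set ((Fin (d 0) → ℝ) → ℝ) :=
  {f | ∃ (l u : Fin (q + 2) → ℝ)
      (g : ∀ i : Fin (q + 1), (Fin (d i.castSucc) → ℝ) → (Fin (d i.succ) → ℝ)),
    l 0 = 0 ∧ u 0 = 1 ∧ (∀ i, l i < u i) ∧
    (∀ i : Fin (q + 1), |l i.succ| ≤ A ∧ |u i.succ| ≤ A) ∧
    (∀ i : Fin (q + 1), Set.MapsTo (g i)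
      (cube (d i.castSucc) (l i.castSucc) (u i.castSucc))
      (cube (d i.succ) (l i.succ) (u i.succ))) ∧
    (∀ (i : Fin (q + 1)) (j : Fin (d i.succ)),
      (fun x => g i x j) ∈
        holderClass (d i.castSucc) (t i) (l i.castSucc) (u i.castSucc) (β i) A) ∧
    ∀ x ∈ cube (d 0) 0 1, ∀ j, f x = composite g (Fin.last (q + 1)) x j}

/-- The class `ℳ₀(c)`: measurable functions with `|m(x)| ≤ c_0 + ∑ c_i |x_i|`. -/
def growthClass {n : ℕ} (c : Fin (n + 1) → ℝ) : Set ((Fin n → ℝ) → ℝ) :=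
  {m | Measurable m ∧ ∀ x, |m x| ≤ c 0 + ∑ i : Fin n, c i.succ * |x i|}

/-- The class `ℳ(c, q, d, t, β, A)`. -/
def meanClass (q : ℕ) (d : Fin (q + 2) → ℕ) (c : Fin (d 0 + 1) → ℝ) (t : Fin (q + 1) → ℕ)
    (β : Fin (q + 1) → ℝ) (A : ℝ) : Set ((Fin (d 0) → ℝ) → ℝ) :=
  growthClass c ∩ compositionClass q d t β A

/-- `β_i^* = β_i ∏_{l > i} min(β_l, 1)`. -/
def effSmoothness {q : ℕ} (β : Fin (q + 1) → ℝ) (i : Fin (q + 1)) : ℝ :=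
  β i * ∏ l ∈ Finset.Ioi i, min (β l) 1

/-- `φ_T = max_i T^{-2 β_i^* / (2 β_i^* + t_i)}`. -/
def rate {q : ℕ} (t : Fin (q + 1) → ℕ) (β : Fin (q + 1) → ℝ) (T : ℕ) : ℝ :=
  Finset.univ.sup' Finset.univ_nonempty fun i =>
    (T : ℝ) ^ (-(2 * effSmoothness β i / (2 * effSmoothness β i + (t i : ℝ))))

/-! ### The autoregressive model -/

/-- `(y, x_1, …, x_{n-1})`, the next vector of lagged values. -/
def pushLag {n : ℕ} (y : ℝ) (x : Fin n → ℝ) : Fin n → ℝ :=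
  fun i => if (i : ℕ) = 0 then y else x ⟨(i : ℕ) - 1, by omega⟩

/-- The sample space of the model: the initial vector `(Y_0, …, Y_{-n+1})` and the noise
sequence; the noise `v_{t+1}` has index `t`. -/
abbrev Sample (n : ℕ) : Type := (Fin n → ℝ) × (ℕ → ℝ)

/-- The initial vector has law `ν` and is independent of the i.i.d. standard normal noise. -/
def modelMeasure {n : ℕ} (ν : Measure (Fin n → ℝ)) : Measure (Sample n) :=
  ν.prod (Measure.infinitePi fun _ : ℕ => gaussianReal 0 1)

/-- The lag vectors: `lagState m ω t` is `X_{t+1} = (Y_t, …, Y_{t-n+1})`. -/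
def lagState {n : ℕ} (m : (Fin n → ℝ) → ℝ) (ω : Sample n) : ℕ → (Fin n → ℝ)
  | 0 => ω.1
  | t + 1 => pushLag (m (lagState m ω t) + ω.2 t) (lagState m ω t)

/-- The response: `response m ω t` is `Y_{t+1} = m(X_{t+1}) + v_{t+1}`. -/
def response {n : ℕ} (m : (Fin n → ℝ) → ℝ) (ω : Sample n) (t : ℕ) : ℝ :=
  m (lagState m ω t) + ω.2 t

/-- The data `(Y_t, X_t)`, `t = 1, …, T`, i.e. the path `Y_{-n+1}, …, Y_T`. -/
def observations {n : ℕ} (m : (Fin n → ℝ) → ℝ) (T : ℕ) (ω : Sample n) :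
    Fin T → ℝ × (Fin n → ℝ) :=
  fun t => (response m ω t, lagState m ω t)

/-- The target `f_0 = m 1_{[0,1]^n}`. -/
def target {n : ℕ} (m : (Fin n → ℝ) → ℝ) : (Fin n → ℝ) → ℝ :=
  (cube n 0 1).indicator m

/-- The estimators from `T` observations: the jointly measurable functions of data and point. -/
def estimators (n T : ℕ) : Set ((Fin T → ℝ × (Fin n → ℝ)) → (Fin n → ℝ) → ℝ) :=
  {f | Measurable (Function.uncurry f)}

/-- The risk `E[T⁻¹ ∑_{t=1}^T (f̂(X_t^*) - f_0(X_t^*))²]` in `[0, ∞]`, where `X^*` is an independent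
copy of `X`: the data come from the first coordinate of a product space, `X^*` from the second. -/
def risk {n : ℕ} (ν : Measure (Fin n → ℝ)) (m : (Fin n → ℝ) → ℝ) (T : ℕ)
    (f : (Fin T → ℝ × (Fin n → ℝ)) → (Fin n → ℝ) → ℝ) : ℝ≥0∞ :=
  ∫⁻ ω : Sample n × Sample n,
    ENNReal.ofReal ((1 / (T : ℝ)) * ∑ t ∈ Finset.range T,
      (f (observations m T ω.1) (lagState m ω.2 t) - target m (lagState m ω.2 t)) ^ 2)
    ∂((modelMeasure ν).prod (modelMeasure ν))

/-- The minimax risk over a class `M` of mean functions. -/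
def minimaxRisk {n : ℕ} (ν : Measure (Fin n → ℝ)) (M : Set ((Fin n → ℝ) → ℝ)) (T : ℕ) : ℝ≥0∞ :=
  ⨅ f ∈ estimators n T, ⨆ m ∈ M, risk ν m T f

end NonlinearAR

end

open NonlinearAR

/-!
The bound comes from Assouad's lemma. Let `i` attain the maximum in `φ_T`. On a grid of mesh
`1 / N` in the first `t_i` coordinates, each vertex `w` of a hypercube with `N ^ t_i` bits selects
cells that carry a smooth bump of height `N ^ (-β_i)`, so that the sum of the bumps is in the
Hölder ball of layer `i` uniformly in `N` and `w`. The layers below `i` only copy coordinates, for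
which the condition on `t` makes the widths sufficient; each layer `l` above `i` is
`x ↦ x ^ min β_l 1`, and the bumps end up with height `N ^ (-β_i^*)`.

The noise has a Gaussian density, so after `d_0` steps the lag vector has a density which is at
most `1` on all of `ℝ ^ d_0`, and, as the mean functions are bounded by `1`, at least a constant
on the unit cube, whatever the initial vector is. Because of the lower bound the risk controls the
integral over the cube of the squared error. Because of the upper bound two models whose vertices
differ in one bit have mean functions at squared distance of order `T N ^ (-2 β_i^* - t_i)` along
the path, up to a negligible contribution of the first `d_0` steps. Their Hellinger affinity is
the expectation, under the midpoint of the two mean functions, of the exponential of `-1 / 8`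
times this distance, and stays away from `0` when `N` is of order `T ^ (1 / (2 β_i^* + t_i))`. No
estimator then determines the bits, and its squared error on the selected half of the cube is of
order `N ^ (-2 β_i^*)`, that is, of order `φ_T`.
-/

noncomputable section

namespace NonlinearAR

/-! ### Sequences of independent, identically distributed variables -/

section IID

variable {α : Type*}

/-- The sequence `a, v 0, v 1, …`. It exposes the first term of an i.i.d. sequence, so that the
model can be analysed by induction on the number of observations. -/
def consSeq (a : α) (v : ℕ → α) : ℕ → α
  | 0 => a
  | k + 1 => v k

@[simp] theorem consSeq_zero (a : α) (v : ℕ → α) : consSeq a v 0 = a := rfl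

@[simp] theorem consSeq_succ (a : α) (v : ℕ → α) (k : ℕ) : consSeq a v (k + 1) = v k := rfl

theorem preimage_consSeq_pi_range (k : ℕ) (s : ℕ → Set α) :
    (fun p : α × (ℕ → α) => consSeq p.1 p.2) ⁻¹' Set.pi (Finset.range (k + 1)) s =
      s 0 ×ˢ Set.pi (Finset.range k) fun i => s (i + 1) := by
  ext ⟨a, v⟩
  simp only [Set.mem_preimage, Set.mem_pi, Set.mem_prod, Finset.coe_range, Set.mem_Iio]
  refine ⟨fun h => ⟨h 0 k.succ_pos, fun i hi => h (i + 1) (Nat.succ_lt_succ hi)⟩, ?_⟩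
  rintro ⟨h0, h⟩ (_ | i) hi
  exacts [h0, h i (Nat.lt_of_succ_lt_succ hi)]

variable [MeasurableSpace α]

theorem measurable_consSeq : Measurable fun p : α × (ℕ → α) => consSeq p.1 p.2 := by
  refine measurable_pi_lambda _ fun k => ?_
  cases k with
  | zero => exact measurable_fst
  | succ k => exact (measurable_pi_apply k).comp measurable_snd

theorem eq_infinitePi_of_pi_range {μ : ℕ → Measure α} [∀ i, IsProbabilityMeasure (μ i)]
    {ρ : Measure (ℕ → α)}
    (h : ∀ k (s : ℕ → Set α), (∀ i, MeasurableSet (s i)) →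
      ρ (Set.pi (Finset.range (k + 1)) s) = ∏ i ∈ Finset.range (k + 1), μ i (s i)) :
    ρ = Measure.infinitePi μ := by
  classical
  refine Measure.eq_infinitePi _ fun I s hs => ?_
  obtain ⟨k, hk⟩ := I.exists_nat_subset_range
  have hI : I ⊆ Finset.range (k + 1) := hk.trans (Finset.range_mono k.le_succ)
  let s' : ℕ → Set α := fun i => if i ∈ I then s i else Set.univ
  have hs' : ∀ i, MeasurableSet (s' i) := fun i => by
    by_cases hi : i ∈ I <;> simp [s', hi, hs i]
  have hpi : Set.pi I s = Set.pi (Finset.range (k + 1)) s' := by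
    ext v
    refine forall_congr' fun i => ?_
    by_cases hi : i ∈ I
    · simp [s', hi, Finset.mem_range_succ_iff.1 (hI hi)]
    · simp [s', hi]
  rw [hpi, h k s' hs', ← Finset.prod_subset hI fun i _ hi => by simp [s', hi]]
  exact Finset.prod_congr rfl fun i hi => by simp [s', hi]

variable (μ : Measure α) [IsProbabilityMeasure μ]

theorem map_consSeq_infinitePi :
    (μ.prod (Measure.infinitePi fun _ : ℕ => μ)).map (fun p => consSeq p.1 p.2) =
      Measure.infinitePi fun _ : ℕ => μ := by
  refine eq_infinitePi_of_pi_range fun k s hs => ?_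
  rw [Measure.map_apply measurable_consSeq
      (.pi (Finset.range (k + 1)).countable_toSet fun i _ => hs i),
    preimage_consSeq_pi_range, Measure.prod_prod,
    Measure.infinitePi_pi _ fun i _ => hs (i + 1), mul_comm, Finset.prod_range_succ']

theorem lintegral_infinitePi_consSeq {F : (ℕ → α) → ℝ≥0∞} (hF : Measurable F) :
    ∫⁻ v, F v ∂(Measure.infinitePi fun _ : ℕ => μ) =
      ∫⁻ a, ∫⁻ v, F (consSeq a v) ∂(Measure.infinitePi fun _ : ℕ => μ) ∂μ := by
  conv_lhs => rw [← map_consSeq_infinitePi]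
  rw [lintegral_map hF measurable_consSeq,
    lintegral_prod (fun p : α × (ℕ → α) => F (consSeq p.1 p.2))
      (hF.comp measurable_consSeq).aemeasurable]

end IID

/-- The law of the noise sequence of the model. -/
abbrev noise : Measure (ℕ → ℝ) := Measure.infinitePi fun _ : ℕ => gaussianReal 0 1

/-! ### Gaussian shifts -/

theorem lintegral_gaussianReal_const_add (μ : ℝ) {F : ℝ → ℝ≥0∞} (hF : Measurable F) :
    ∫⁻ a, F (μ + a) ∂gaussianReal 0 1 = ∫⁻ b, F b ∂gaussianReal μ 1 := by
  rw [← lintegral_map (f := F) (g := fun a => μ + a) hF (by fun_prop), gaussianReal_map_const_add,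
    zero_add]

theorem gaussianPDF_eq_exp_mul (μ b : ℝ) :
    gaussianPDF μ 1 b = ENNReal.ofReal (Real.exp (μ * b - μ ^ 2 / 2)) * gaussianPDF 0 1 b := by
  rw [gaussianPDF, gaussianPDF, ← ENNReal.ofReal_mul (Real.exp_pos _).le]
  simp only [gaussianPDFReal, NNReal.coe_one, mul_one, sub_zero]
  rw [mul_left_comm, ← Real.exp_add]
  ring_nf

theorem gaussianReal_eq_withDensity_exp (μ : ℝ) :
    gaussianReal μ 1 =
      (gaussianReal 0 1).withDensity fun b => ENNReal.ofReal (Real.exp (μ * b - μ ^ 2 / 2)) := by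
  rw [gaussianReal_of_var_ne_zero _ one_ne_zero, gaussianReal_of_var_ne_zero _ one_ne_zero,
    ← withDensity_mul _ (measurable_gaussianPDF _ _) (by fun_prop)]
  congr 1 with b
  rw [Pi.mul_apply, mul_comm, gaussianPDF_eq_exp_mul]

theorem gaussianPDF_le_one (μ b : ℝ) : gaussianPDF μ 1 b ≤ 1 := by
  rw [gaussianPDF, ← ENNReal.ofReal_one]
  refine ENNReal.ofReal_le_ofReal ?_
  simp only [gaussianPDFReal, NNReal.coe_one, mul_one]
  have h1 : 1 ≤ √(2 * Real.pi) := by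
    rw [Real.one_le_sqrt]
    linarith [Real.pi_gt_three]
  have h2 : Real.exp (-(b - μ) ^ 2 / 2) ≤ 1 := by
    rw [Real.exp_le_one_iff]
    linarith [sq_nonneg (b - μ)]
  exact mul_le_one₀ (inv_le_one_of_one_le₀ h1) (Real.exp_pos _).le h2

theorem gaussianReal_le_volume (μ : ℝ) : gaussianReal μ 1 ≤ volume := by
  rw [gaussianReal_of_var_ne_zero _ one_ne_zero]
  calc volume.withDensity (gaussianPDF μ 1) ≤ volume.withDensity 1 :=
        withDensity_mono (.of_forall (gaussianPDF_le_one μ))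
    _ = volume := withDensity_one

theorem gaussianPDF_le_of_abs_sub_le {μ b R : ℝ} (h : |b - μ| ≤ R) :
    gaussianPDF 0 1 R ≤ gaussianPDF μ 1 b := by
  refine ENNReal.ofReal_le_ofReal ?_
  simp only [gaussianPDFReal, NNReal.coe_one, mul_one, sub_zero]
  have hsq : (b - μ) ^ 2 ≤ R ^ 2 := sq_le_sq' (abs_le.1 h).1 (abs_le.1 h).2
  gcongr

theorem smul_restrict_le_gaussianReal {μ R : ℝ} {s : Set ℝ} (hs : MeasurableSet s)
    (h : ∀ b ∈ s, |b - μ| ≤ R) :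
    gaussianPDF 0 1 R • volume.restrict s ≤ gaussianReal μ 1 := by
  rw [gaussianReal_of_var_ne_zero _ one_ne_zero, ← withDensity_const]
  calc (volume.restrict s).withDensity (fun _ => gaussianPDF 0 1 R)
      ≤ (volume.restrict s).withDensity (gaussianPDF μ 1) :=
        withDensity_mono ((ae_restrict_iff' hs).2 <| .of_forall fun b hb =>
          gaussianPDF_le_of_abs_sub_le (h b hb))
    _ ≤ volume.withDensity (gaussianPDF μ 1) := by
        rw [← restrict_withDensity hs]
        exact Measure.restrict_le_self

/-! ### The autoregression as a recursion in the first noise variable -/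

section Recursion

variable {n : ℕ}

@[fun_prop]
theorem measurable_pushLag {Ω : Type*} [MeasurableSpace Ω] {f : Ω → ℝ} {g : Ω → Fin n → ℝ}
    (hf : Measurable f) (hg : Measurable g) : Measurable fun ω => pushLag (f ω) (g ω) := by
  refine measurable_pi_lambda _ fun i => ?_
  unfold pushLag
  split_ifs <;> fun_prop

@[fun_prop]
theorem measurable_finCons {Ω α : Type*} [MeasurableSpace Ω] [MeasurableSpace α] {T : ℕ}
    {f : Ω → α} {g : Ω → Fin T → α} (hf : Measurable f) (hg : Measurable g) :
    Measurable fun ω => (Fin.cons (f ω) (g ω) : Fin (T + 1) → α) := by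
  refine measurable_pi_lambda _ fun t => ?_
  cases t using Fin.cases with
  | zero => exact hf
  | succ t => simpa only [Fin.cons_succ] using measurable_pi_iff.1 hg t

theorem measurable_lagState {m : (Fin n → ℝ) → ℝ} (hm : Measurable m) (t : ℕ) :
    Measurable fun ω : Sample n => lagState m ω t := by
  induction t with
  | zero => exact measurable_fst
  | succ t ih =>
    simp only [lagState]
    fun_prop

theorem measurable_observations {m : (Fin n → ℝ) → ℝ} (hm : Measurable m) (T : ℕ) :
    Measurable (observations m T) := by
  have := measurable_lagState hm
  unfold observations response
  fun_prop

theorem lagState_consSeq (m : (Fin n → ℝ) → ℝ) (x : Fin n → ℝ) (a : ℝ) (v : ℕ → ℝ) (t : ℕ) :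
    lagState m (x, consSeq a v) (t + 1) = lagState m (pushLag (m x + a) x, v) t := by
  induction t with
  | zero => rfl
  | succ t ih => rw [lagState, ih]; rfl

theorem observations_consSeq (m : (Fin n → ℝ) → ℝ) (x : Fin n → ℝ) (a : ℝ) (v : ℕ → ℝ) (T : ℕ) :
    observations m (T + 1) (x, consSeq a v) =
      (Fin.cons (m x + a, x) (observations m T (pushLag (m x + a) x, v)) :
        Fin (T + 1) → ℝ × (Fin n → ℝ)) := by
  funext t
  cases t using Fin.cases with
  | zero => rfl
  | succ t =>
    simp only [Fin.cons_succ, observations, response, Fin.val_succ, lagState_consSeq, consSeq_succ]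

theorem lintegral_observations_succ {m : (Fin n → ℝ) → ℝ} (hm : Measurable m) {T : ℕ}
    (x : Fin n → ℝ) {H : (Fin (T + 1) → ℝ × (Fin n → ℝ)) → ℝ≥0∞} (hH : Measurable H) :
    ∫⁻ v, H (observations m (T + 1) (x, v)) ∂noise =
      ∫⁻ a, ∫⁻ v, H (Fin.cons (m x + a, x) (observations m T (pushLag (m x + a) x, v))) ∂noise
        ∂gaussianReal 0 1 := by
  have hobs := measurable_observations hm (T + 1)
  rw [lintegral_infinitePi_consSeq (gaussianReal 0 1)
    (F := fun v => H (observations m (T + 1) (x, v))) (by fun_prop)]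
  simp only [observations_consSeq]

end Recursion

/-! ### The likelihood -/

section Likelihood

variable {n : ℕ}

/-- The logarithm of the likelihood of the data under the mean function `m`, relative to the model
with mean function `0`. -/
def logLik (m : (Fin n → ℝ) → ℝ) (T : ℕ) (o : Fin T → ℝ × (Fin n → ℝ)) : ℝ :=
  ∑ t, (m (o t).2 * (o t).1 - m (o t).2 ^ 2 / 2)

theorem measurable_logLik {m : (Fin n → ℝ) → ℝ} (hm : Measurable m) (T : ℕ) :
    Measurable (logLik m T) := by
  unfold logLik
  fun_prop

theorem logLik_cons (m : (Fin n → ℝ) → ℝ) {T : ℕ} (y : ℝ) (x : Fin n → ℝ)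
    (o : Fin T → ℝ × (Fin n → ℝ)) :
    logLik m (T + 1) (Fin.cons (y, x) o) = (m x * y - m x ^ 2 / 2) + logLik m T o := by
  simp only [logLik, Fin.sum_univ_succ, Fin.cons_zero, Fin.cons_succ]

theorem lintegral_observations_eq_exp_logLik {m : (Fin n → ℝ) → ℝ} (hm : Measurable m) (T : ℕ)
    (x : Fin n → ℝ) {H : (Fin T → ℝ × (Fin n → ℝ)) → ℝ≥0∞} (hH : Measurable H) :
    ∫⁻ v, H (observations m T (x, v)) ∂noise =
      ∫⁻ v, ENNReal.ofReal (Real.exp (logLik m T (observations 0 T (x, v)))) *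
        H (observations 0 T (x, v)) ∂noise := by
  induction T generalizing x with
  | zero =>
    refine lintegral_congr fun v => ?_
    rw [Subsingleton.elim (observations m 0 (x, v)) (observations 0 0 (x, v))]
    simp [logLik]
  | succ T ih =>
    have h0 : Measurable (0 : (Fin n → ℝ) → ℝ) := measurable_const
    have hobs := measurable_observations h0 T
    have hL := measurable_logLik hm
    let G (b : ℝ) (v : ℕ → ℝ) : ℝ≥0∞ :=
      ENNReal.ofReal (Real.exp (logLik m T (observations 0 T (pushLag b x, v)))) *
        H (Fin.cons (b, x) (observations 0 T (pushLag b x, v)))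
    have hG : Measurable fun p : ℝ × (ℕ → ℝ) => G p.1 p.2 := by fun_prop
    calc ∫⁻ v, H (observations m (T + 1) (x, v)) ∂noise
        = ∫⁻ a, ∫⁻ v, G (m x + a) v ∂noise ∂gaussianReal 0 1 := by
          rw [lintegral_observations_succ hm x hH]
          exact lintegral_congr fun a => ih _ (H := fun o => H (Fin.cons (m x + a, x) o))
            (by fun_prop)
      _ = ∫⁻ b, ∫⁻ v, ENNReal.ofReal (Real.exp (m x * b - m x ^ 2 / 2)) * G b v ∂noise
            ∂gaussianReal 0 1 := by
          rw [lintegral_gaussianReal_const_add _ hG.lintegral_prod_right',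
            gaussianReal_eq_withDensity_exp,
            lintegral_withDensity_eq_lintegral_mul _ (by fun_prop) hG.lintegral_prod_right']
          exact lintegral_congr fun b => (lintegral_const_mul _ (by fun_prop)).symm
      _ = _ := by
          rw [lintegral_observations_succ h0 x (H := fun o =>
            ENNReal.ofReal (Real.exp (logLik m (T + 1) o)) * H o) (by fun_prop)]
          refine lintegral_congr fun b => lintegral_congr fun v => ?_
          simp only [Pi.zero_apply, zero_add, logLik_cons, Real.exp_add,
            ENNReal.ofReal_mul (Real.exp_pos _).le, mul_assoc, G]

theorem lintegral_exp_logLik {m : (Fin n → ℝ) → ℝ} (hm : Measurable m) (T : ℕ) (x : Fin n → ℝ) :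
    ∫⁻ v, ENNReal.ofReal (Real.exp (logLik m T (observations 0 T (x, v)))) ∂noise = 1 := by
  simpa using
    (lintegral_observations_eq_exp_logLik hm T x (H := fun _ => 1) measurable_const).symm

end Likelihood

/-! ### Testing two mean functions -/

section TwoPoint

theorem ofReal_sub_sq (x y : ℝ) : ENNReal.ofReal ((x - y) ^ 2) = edist x y ^ 2 := by
  rw [edist_dist, Real.dist_eq, ← ENNReal.ofReal_pow (abs_nonneg _), sq_abs]

theorem add_sq_le_two_mul (a b : ℝ≥0∞) : (a + b) ^ 2 ≤ 2 * (a ^ 2 + b ^ 2) := by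
  have h := ENNReal.rpow_add_le_mul_rpow_add_rpow a b one_le_two
  norm_num at h
  exact h

variable {Ω : Type*} [MeasurableSpace Ω] {P : Measure Ω}

theorem sq_lintegral_mul_le {f g : Ω → ℝ≥0∞} (hf : AEMeasurable f P) (hg : AEMeasurable g P) :
    (∫⁻ ω, f ω * g ω ∂P) ^ 2 ≤ (∫⁻ ω, f ω ^ 2 ∂P) * ∫⁻ ω, g ω ^ 2 ∂P := by
  have h := ENNReal.lintegral_mul_le_Lp_mul_Lq P Real.HolderConjugate.two_two hf hg
  simp only [Pi.mul_apply, ENNReal.rpow_two] at h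
  calc (∫⁻ ω, f ω * g ω ∂P) ^ 2
      ≤ ((∫⁻ ω, f ω ^ 2 ∂P) ^ (1 / 2 : ℝ) * (∫⁻ ω, g ω ^ 2 ∂P) ^ (1 / 2 : ℝ)) ^ 2 := by gcongr
    _ = (∫⁻ ω, f ω ^ 2 ∂P) * ∫⁻ ω, g ω ^ 2 ∂P := by
        simp only [mul_pow, ← ENNReal.rpow_natCast, ← ENNReal.rpow_mul]
        norm_num

/-- Le Cam: `∫ s₀ s₁ ∂P` is the Hellinger affinity of two laws with square-root densities
`s₀`, `s₁`. -/
theorem edist_sq_mul_sq_affinity_le {E : Type*} [PseudoEMetricSpace E] [MeasurableSpace E]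
    [OpensMeasurableSpace E] {s₀ s₁ : Ω → ℝ≥0∞} (hs₀ : Measurable s₀) (hs₁ : Measurable s₁)
    (h₀ : ∫⁻ ω, s₀ ω ^ 2 ∂P ≤ 1) (h₁ : ∫⁻ ω, s₁ ω ^ 2 ∂P ≤ 1) {h : Ω → E} (hh : Measurable h)
    (a₀ a₁ : E) :
    edist a₀ a₁ ^ 2 * (∫⁻ ω, s₀ ω * s₁ ω ∂P) ^ 2 ≤
      2 * (∫⁻ ω, s₀ ω ^ 2 * edist (h ω) a₀ ^ 2 ∂P + ∫⁻ ω, s₁ ω ^ 2 * edist (h ω) a₁ ^ 2 ∂P) := by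
  have hd (a : E) : Measurable fun ω => edist (h ω) a := measurable_edist_left.comp hh
  have cauchySchwarz {s s' : Ω → ℝ≥0∞} (hs : Measurable s) (hs' : Measurable s')
      (hs1 : ∫⁻ ω, s' ω ^ 2 ∂P ≤ 1) (a : E) :
      (∫⁻ ω, s ω * edist (h ω) a * s' ω ∂P) ^ 2 ≤ ∫⁻ ω, s ω ^ 2 * edist (h ω) a ^ 2 ∂P := by
    refine (sq_lintegral_mul_le (f := fun ω => s ω * edist (h ω) a)
      (hs.mul (hd a)).aemeasurable hs'.aemeasurable).trans ?_
    simpa only [mul_pow] using mul_le_of_le_one_right' hs1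
  have htri : edist a₀ a₁ * ∫⁻ ω, s₀ ω * s₁ ω ∂P ≤
      ∫⁻ ω, s₀ ω * edist (h ω) a₀ * s₁ ω ∂P + ∫⁻ ω, s₁ ω * edist (h ω) a₁ * s₀ ω ∂P := by
    rw [← lintegral_const_mul _ (by fun_prop), ← lintegral_add_left (by fun_prop)]
    refine lintegral_mono fun ω => ?_
    calc edist a₀ a₁ * (s₀ ω * s₁ ω)
        ≤ (edist (h ω) a₀ + edist (h ω) a₁) * (s₀ ω * s₁ ω) := by
          gcongr
          exact edist_triangle_left _ _ _
      _ = s₀ ω * edist (h ω) a₀ * s₁ ω + s₁ ω * edist (h ω) a₁ * s₀ ω := by ring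
  calc edist a₀ a₁ ^ 2 * (∫⁻ ω, s₀ ω * s₁ ω ∂P) ^ 2
      ≤ (∫⁻ ω, s₀ ω * edist (h ω) a₀ * s₁ ω ∂P + ∫⁻ ω, s₁ ω * edist (h ω) a₁ * s₀ ω ∂P) ^ 2 := by
        rw [← mul_pow]
        gcongr
    _ ≤ 2 * ((∫⁻ ω, s₀ ω * edist (h ω) a₀ * s₁ ω ∂P) ^ 2 +
          (∫⁻ ω, s₁ ω * edist (h ω) a₁ * s₀ ω ∂P) ^ 2) := add_sq_le_two_mul _ _
    _ ≤ 2 * (∫⁻ ω, s₀ ω ^ 2 * edist (h ω) a₀ ^ 2 ∂P + ∫⁻ ω, s₁ ω ^ 2 * edist (h ω) a₁ ^ 2 ∂P) := by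
        gcongr
        exacts [cauchySchwarz hs₀ hs₁ h₁ a₀, cauchySchwarz hs₁ hs₀ h₀ a₁]

end TwoPoint

section Affinity

variable {n : ℕ} {m₀ m₁ : (Fin n → ℝ) → ℝ}

theorem logLik_add_logLik_div_two (m₀ m₁ : (Fin n → ℝ) → ℝ) (T : ℕ)
    (o : Fin T → ℝ × (Fin n → ℝ)) :
    (logLik m₀ T o + logLik m₁ T o) / 2 = logLik (midpoint ℝ m₀ m₁) T o +
      -((∑ t, (m₀ (o t).2 - m₁ (o t).2) ^ 2) / 8) := by
  simp only [logLik, ← Finset.sum_add_distrib, Finset.sum_div, ← Finset.sum_neg_distrib,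
    midpoint_eq_smul_add, Pi.smul_apply, Pi.add_apply, smul_eq_mul, invOf_eq_inv]
  exact Finset.sum_congr rfl fun t _ => by ring

theorem measurable_midpoint (hm₀ : Measurable m₀) (hm₁ : Measurable m₁) :
    Measurable (midpoint ℝ m₀ m₁) := by
  rw [midpoint_eq_smul_add]
  fun_prop

/-- The square root of the likelihood of the data under `m`, relative to the model with mean
function `0`. -/
def sqrtLik (m : (Fin n → ℝ) → ℝ) (T : ℕ) (o : Fin T → ℝ × (Fin n → ℝ)) : ℝ≥0∞ :=
  ENNReal.ofReal (Real.exp (logLik m T o / 2))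

theorem measurable_sqrtLik {m : (Fin n → ℝ) → ℝ} (hm : Measurable m) (T : ℕ) :
    Measurable (sqrtLik m T) := by
  have := measurable_logLik hm T
  unfold sqrtLik
  fun_prop

theorem sqrtLik_sq (m : (Fin n → ℝ) → ℝ) (T : ℕ) (o : Fin T → ℝ × (Fin n → ℝ)) :
    sqrtLik m T o ^ 2 = ENNReal.ofReal (Real.exp (logLik m T o)) := by
  rw [sqrtLik, ← ENNReal.ofReal_pow (Real.exp_pos _).le, ← Real.exp_nat_mul, Nat.cast_ofNat,
    mul_div_cancel₀ _ two_ne_zero]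

theorem sqrtLik_mul_sqrtLik (m₀ m₁ : (Fin n → ℝ) → ℝ) (T : ℕ) (o : Fin T → ℝ × (Fin n → ℝ)) :
    sqrtLik m₀ T o * sqrtLik m₁ T o = ENNReal.ofReal (Real.exp (logLik (midpoint ℝ m₀ m₁) T o)) *
      ENNReal.ofReal (Real.exp (-((∑ t, (m₀ (o t).2 - m₁ (o t).2) ^ 2) / 8))) := by
  simp only [sqrtLik, ← ENNReal.ofReal_mul (Real.exp_pos _).le, ← Real.exp_add, ← add_div,
    logLik_add_logLik_div_two]

theorem one_le_ofReal_exp_neg_add {y : ℝ} (hy : 0 ≤ y) :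
    1 ≤ ENNReal.ofReal (Real.exp (-y)) + ENNReal.ofReal y := by
  rw [← ENNReal.ofReal_add (Real.exp_pos _).le hy, ← ENNReal.ofReal_one]
  exact ENNReal.ofReal_le_ofReal (by linarith [Real.add_one_le_exp (-y)])

/-- By `sqrtLik_mul_sqrtLik`, the affinity of the models `m₀` and `m₁` is an expectation under
their midpoint. -/
theorem one_le_affinity_add (hm₀ : Measurable m₀) (hm₁ : Measurable m₁) (T : ℕ)
    (x : Fin n → ℝ) :
    1 ≤ ∫⁻ v, sqrtLik m₀ T (observations 0 T (x, v)) *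
          sqrtLik m₁ T (observations 0 T (x, v)) ∂noise +
        (∫⁻ v, ∑ t : Fin T, edist (m₀ (lagState (midpoint ℝ m₀ m₁) (x, v) t))
          (m₁ (lagState (midpoint ℝ m₀ m₁) (x, v) t)) ^ 2 ∂noise) / 8 := by
  have hmid := measurable_midpoint hm₀ hm₁
  have hobs := measurable_observations hmid T
  let D (o : Fin T → ℝ × (Fin n → ℝ)) : ℝ := (∑ t, (m₀ (o t).2 - m₁ (o t).2) ^ 2) / 8
  have hD : Measurable D := by fun_prop
  have hD0 (o) : 0 ≤ D o := div_nonneg (Finset.sum_nonneg fun _ _ => sq_nonneg _) (by norm_num)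
  have hchange : ∫⁻ v, sqrtLik m₀ T (observations 0 T (x, v)) *
      sqrtLik m₁ T (observations 0 T (x, v)) ∂noise =
      ∫⁻ v, ENNReal.ofReal (Real.exp (-D (observations (midpoint ℝ m₀ m₁) T (x, v)))) ∂noise := by
    rw [lintegral_observations_eq_exp_logLik hmid T x
      (H := fun o => ENNReal.ofReal (Real.exp (-D o))) (by fun_prop)]
    simp only [sqrtLik_mul_sqrtLik, D]
  have hdist : (∫⁻ v, ∑ t : Fin T, edist (m₀ (lagState (midpoint ℝ m₀ m₁) (x, v) t))
      (m₁ (lagState (midpoint ℝ m₀ m₁) (x, v) t)) ^ 2 ∂noise) / 8 =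
      ∫⁻ v, ENNReal.ofReal (D (observations (midpoint ℝ m₀ m₁) T (x, v))) ∂noise := by
    rw [div_eq_mul_inv, ← lintegral_mul_const' _ _ (by simp)]
    refine lintegral_congr fun v => ?_
    rw [← div_eq_mul_inv, ENNReal.ofReal_div_of_pos (by norm_num),
      ENNReal.ofReal_sum_of_nonneg fun _ _ => sq_nonneg _, ENNReal.ofReal_ofNat]
    simp only [ofReal_sub_sq, observations]
  rw [hchange, hdist, ← lintegral_add_left (by fun_prop)]
  calc (1 : ℝ≥0∞) = ∫⁻ _, 1 ∂noise := by simp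
    _ ≤ _ := lintegral_mono fun v => one_le_ofReal_exp_neg_add (hD0 _)

theorem three_quarters_le_of_one_le_add {a b : ℝ≥0∞} (h : 1 ≤ a + b / 8) (hb : b ≤ 2) :
    3 / 4 ≤ a := by
  have hsplit : (3 / 4 : ℝ≥0∞) + 1 / 4 = 1 := by
    rw [← ENNReal.add_div, ENNReal.div_eq_one_iff (by norm_num) (by norm_num)]
    norm_num
  have hquarter : b / 8 ≤ 1 / 4 := by
    refine (ENNReal.div_le_div_right hb 8).trans_eq ?_
    rw [ENNReal.div_eq_div_iff (by norm_num) (by norm_num) (by norm_num) (by norm_num)]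
    norm_num
  refine (ENNReal.add_le_add_iff_right (a := 1 / 4) (by norm_num)).1 ?_
  rw [hsplit]
  exact h.trans (add_le_add_right hquarter a)

theorem edist_sq_div_four_le (hm₀ : Measurable m₀) (hm₁ : Measurable m₁) {T : ℕ}
    {x : Fin n → ℝ}
    (hD : ∫⁻ v, ∑ t : Fin T, edist (m₀ (lagState (midpoint ℝ m₀ m₁) (x, v) t))
      (m₁ (lagState (midpoint ℝ m₀ m₁) (x, v) t)) ^ 2 ∂noise ≤ 2)
    {E : Type*} [PseudoEMetricSpace E] [MeasurableSpace E] [OpensMeasurableSpace E]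
    {h : (Fin T → ℝ × (Fin n → ℝ)) → E} (hh : Measurable h) (a₀ a₁ : E) :
    edist a₀ a₁ ^ 2 / 4 ≤ ∫⁻ v, edist (h (observations m₀ T (x, v))) a₀ ^ 2 ∂noise +
      ∫⁻ v, edist (h (observations m₁ T (x, v))) a₁ ^ 2 ∂noise := by
  have hobs := measurable_observations (m := (0 : (Fin n → ℝ) → ℝ)) measurable_const T
  have hdist (a : E) : Measurable fun o => edist (h o) a ^ 2 :=
    (measurable_edist_left.comp hh).pow_const 2
  have hs {m : (Fin n → ℝ) → ℝ} (hm : Measurable m) :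
      Measurable fun v => sqrtLik m T (observations 0 T (x, v)) := by
    have := measurable_sqrtLik hm T
    fun_prop
  have hs_one {m : (Fin n → ℝ) → ℝ} (hm : Measurable m) :
      ∫⁻ v, sqrtLik m T (observations 0 T (x, v)) ^ 2 ∂noise ≤ 1 := by
    simp only [sqrtLik_sq, lintegral_exp_logLik hm, le_refl]
  have haff := three_quarters_le_of_one_le_add (one_le_affinity_add hm₀ hm₁ T x) hD
  have hhalf : (1 / 2 : ℝ≥0∞) ≤ (3 / 4) ^ 2 := by
    rw [← ENNReal.toReal_le_toReal (by norm_num) (by finiteness)]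
    norm_num
  rw [lintegral_observations_eq_exp_logLik hm₀ T x (hdist a₀),
    lintegral_observations_eq_exp_logLik hm₁ T x (hdist a₁)]
  simp only [← sqrtLik_sq]
  refine (ENNReal.mul_le_mul_iff_right two_ne_zero ENNReal.ofNat_ne_top).1 ?_
  calc 2 * (edist a₀ a₁ ^ 2 / 4)
      = edist a₀ a₁ ^ 2 * (1 / 2) := by
        rw [← mul_div_assoc, mul_comm, mul_div_assoc]
        congr 1
        rw [ENNReal.div_eq_div_iff (by norm_num) (by norm_num) (by norm_num) (by norm_num)]
        norm_num
    _ ≤ edist a₀ a₁ ^ 2 * (∫⁻ v, sqrtLik m₀ T (observations 0 T (x, v)) *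
          sqrtLik m₁ T (observations 0 T (x, v)) ∂noise) ^ 2 := by
        gcongr
        exact hhalf.trans (pow_le_pow_left' haff 2)
    _ ≤ _ := edist_sq_mul_sq_affinity_le (hs hm₀) (hs hm₁) (hs_one hm₀) (hs_one hm₁)
        (h := fun v => h (observations 0 T (x, v))) (by fun_prop) a₀ a₁

end Affinity

/-! ### The occupation measure -/

section Occupation

variable {n : ℕ} {m : (Fin n → ℝ) → ℝ} {g : (Fin n → ℝ) → ℝ≥0∞}

/-- The lag vector after `k` steps from `x`, the values in these steps being `y`, the most recent
one first. -/
def mergeLag (k : ℕ) (y : Fin k → ℝ) (x : Fin n → ℝ) : Fin n → ℝ :=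
  fun i => if h : (i : ℕ) < k then y ⟨i, h⟩ else x ⟨(i : ℕ) - k, by omega⟩

theorem mergeLag_zero (y : Fin 0 → ℝ) (x : Fin n → ℝ) : mergeLag 0 y x = x := by
  funext i
  simp [mergeLag]

theorem mergeLag_self (y x : Fin n → ℝ) : mergeLag n y x = y := by
  funext i
  simp [mergeLag]

theorem mergeLag_pushLag {k : ℕ} (y : Fin k → ℝ) (b : ℝ) (x : Fin n → ℝ) :
    mergeLag k y (pushLag b x) = mergeLag (k + 1) (Fin.snoc y b : Fin (k + 1) → ℝ) x := by
  funext i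
  simp only [mergeLag, pushLag, Fin.snoc]
  rcases lt_trichotomy (i : ℕ) k with h | h | h
  · simp [h, h.trans k.lt_succ_self]
  · simp [h]
  · have hlt : ¬(i : ℕ) < k + 1 := by omega
    have hsub : (i : ℕ) - k ≠ 0 := by omega
    simp only [h.not_gt, hlt, hsub, dite_false, if_false]
    congr 1

@[fun_prop]
theorem measurable_mergeLag {Ω : Type*} [MeasurableSpace Ω] {k : ℕ} {y : Ω → Fin k → ℝ}
    {x : Ω → Fin n → ℝ} (hy : Measurable y) (hx : Measurable x) :
    Measurable fun ω => mergeLag k (y ω) (x ω) := by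
  refine measurable_pi_lambda _ fun i => ?_
  unfold mergeLag
  split_ifs <;> fun_prop

theorem lintegral_mergeLag_succ (ρ : Measure ℝ) [SigmaFinite ρ] (k : ℕ) (hg : Measurable g)
    (x : Fin n → ℝ) :
    ∫⁻ y, g (mergeLag (k + 1) y x) ∂Measure.pi (fun _ => ρ) =
      ∫⁻ b, ∫⁻ y, g (mergeLag k y (pushLag b x)) ∂Measure.pi (fun _ => ρ) ∂ρ := by
  have hsnoc := (measurePreserving_piFinSuccAbove (fun _ : Fin (k + 1) => ρ) (Fin.last k)).symm
  rw [← hsnoc.lintegral_comp (f := fun y => g (mergeLag (k + 1) y x)) (by fun_prop),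
    ← lintegral_prod (fun p : ℝ × (Fin k → ℝ) => g (mergeLag k p.2 (pushLag p.1 x)))
      (Measurable.aemeasurable (by fun_prop))]
  refine lintegral_congr fun p => ?_
  rw [mergeLag_pushLag]
  congr 2
  simp [MeasurableEquiv.piFinSuccAbove, Fin.insertNthEquiv]

theorem lintegral_lagState_succ (hm : Measurable m) (k : ℕ) (hg : Measurable g)
    (x : Fin n → ℝ) :
    ∫⁻ v, g (lagState m (x, v) (k + 1)) ∂noise =
      ∫⁻ b, ∫⁻ v, g (lagState m (pushLag b x, v) k) ∂noise ∂gaussianReal (m x) 1 := by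
  have hstate := measurable_lagState hm
  have hG : Measurable fun p : ℝ × (ℕ → ℝ) => g (lagState m (pushLag p.1 x, p.2) k) := by
    fun_prop
  rw [← lintegral_gaussianReal_const_add _ hG.lintegral_prod_right',
    lintegral_infinitePi_consSeq _ (F := fun v => g (lagState m (x, v) (k + 1))) (by fun_prop)]
  simp only [lagState_consSeq]

theorem pow_mul_lintegral_mergeLag_le_lintegral_lagState (hm : Measurable m) {ρ : Measure ℝ}
    [SigmaFinite ρ] {c : ℝ≥0∞} (hρ : ∀ x, c • ρ ≤ gaussianReal (m x) 1) (k : ℕ)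
    (hg : Measurable g) (x : Fin n → ℝ) :
    c ^ k * ∫⁻ y, g (mergeLag k y x) ∂Measure.pi (fun _ => ρ) ≤
      ∫⁻ v, g (lagState m (x, v) k) ∂noise := by
  induction k generalizing x with
  | zero => simp [mergeLag_zero, lagState]
  | succ k ih =>
    rw [lintegral_lagState_succ hm k hg, lintegral_mergeLag_succ _ k hg]
    let G (b : ℝ) : ℝ≥0∞ := ∫⁻ y, g (mergeLag k y (pushLag b x)) ∂Measure.pi (fun _ => ρ)
    have hG : Measurable G := Measurable.lintegral_prod_right'
      (f := fun p : ℝ × (Fin k → ℝ) => g (mergeLag k p.2 (pushLag p.1 x))) (by fun_prop)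
    calc c ^ (k + 1) * ∫⁻ b, G b ∂ρ = ∫⁻ b, c ^ k * G b ∂(c • ρ) := by
          rw [lintegral_smul_measure, lintegral_const_mul _ hG, smul_eq_mul, pow_succ']
          ring
      _ ≤ ∫⁻ b, c ^ k * G b ∂gaussianReal (m x) 1 := lintegral_mono' (hρ x) le_rfl
      _ ≤ _ := lintegral_mono fun b => ih _

theorem lintegral_lagState_le_lintegral_mergeLag (hm : Measurable m) {ρ : Measure ℝ}
    [SigmaFinite ρ] (hρ : ∀ x, gaussianReal (m x) 1 ≤ ρ) (k : ℕ) (hg : Measurable g)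
    (x : Fin n → ℝ) :
    ∫⁻ v, g (lagState m (x, v) k) ∂noise ≤
      ∫⁻ y, g (mergeLag k y x) ∂Measure.pi (fun _ => ρ) := by
  induction k generalizing x with
  | zero => simp [mergeLag_zero, lagState]
  | succ k ih =>
    rw [lintegral_lagState_succ hm k hg, lintegral_mergeLag_succ _ k hg]
    exact lintegral_mono' (hρ x) fun b => ih _

/-- After `n` steps the initial vector is forgotten, whence a bound uniform in `t`. -/
theorem setLIntegral_cube_le_lintegral_lagState (hm : Measurable m) {K : ℝ}
    (hK : ∀ x, |m x| ≤ K) {t : ℕ} (ht : n ≤ t) (hg : Measurable g) (x : Fin n → ℝ) :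
    gaussianPDF 0 1 (K + 1) ^ n * ∫⁻ y in cube n 0 1, g y ≤
      ∫⁻ v, g (lagState m (x, v) t) ∂noise := by
  induction t, ht using Nat.le_induction generalizing x with
  | base =>
    have hρ (x : Fin n → ℝ) : gaussianPDF 0 1 (K + 1) • volume.restrict (Set.Icc (0 : ℝ) 1) ≤
        gaussianReal (m x) 1 := by
      refine smul_restrict_le_gaussianReal measurableSet_Icc fun b hb => ?_
      obtain ⟨hlo, hhi⟩ := abs_le.1 (hK x)
      exact abs_le.2 ⟨by linarith [hb.1], by linarith [hb.2]⟩
    have h := pow_mul_lintegral_mergeLag_le_lintegral_lagState hm hρ n hg x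
    simp only [mergeLag_self] at h
    rwa [cube, ← Set.pi_univ_Icc, volume_pi, Measure.restrict_pi_pi]
  | succ t _ ih =>
    rw [lintegral_lagState_succ hm t hg]
    calc _ = ∫⁻ _, (gaussianPDF 0 1 (K + 1) ^ n * ∫⁻ y in cube n 0 1, g y)
          ∂gaussianReal (m x) 1 := by simp
      _ ≤ _ := lintegral_mono fun b => ih _

theorem lintegral_lagState_le_lintegral (hm : Measurable m) {t : ℕ} (ht : n ≤ t)
    (hg : Measurable g) (x : Fin n → ℝ) :
    ∫⁻ v, g (lagState m (x, v) t) ∂noise ≤ ∫⁻ y, g y := by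
  induction t, ht using Nat.le_induction generalizing x with
  | base =>
    simpa only [mergeLag_self, ← volume_pi] using
      lintegral_lagState_le_lintegral_mergeLag hm (fun x => gaussianReal_le_volume (m x)) n hg x
  | succ t _ ih =>
    rw [lintegral_lagState_succ hm t hg]
    calc _ ≤ ∫⁻ _, (∫⁻ y, g y) ∂gaussianReal (m x) 1 := lintegral_mono fun b => ih _
      _ = _ := by simp

theorem lintegral_sum_lagState_le (hm : Measurable m) (hg : Measurable g) {B : ℝ≥0∞}
    (hB : ∀ y, g y ≤ B) (T : ℕ) (x : Fin n → ℝ) :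
    ∫⁻ v, ∑ t : Fin T, g (lagState m (x, v) t) ∂noise ≤ n * B + T * ∫⁻ y, g y := by
  have hstate := measurable_lagState hm
  have hburn (t : ℕ) : ∫⁻ v, g (lagState m (x, v) t) ∂noise ≤ B :=
    (lintegral_mono fun v => hB _).trans_eq (by simp)
  calc ∫⁻ v, ∑ t : Fin T, g (lagState m (x, v) t) ∂noise
      = ∑ t ∈ Finset.range T, ∫⁻ v, g (lagState m (x, v) t) ∂noise := by
        rw [lintegral_finsetSum _ fun t _ => by fun_prop, Finset.sum_range]
    _ ≤ ∑ t ∈ Finset.range (n + T), ∫⁻ v, g (lagState m (x, v) t) ∂noise :=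
        Finset.sum_le_sum_of_subset (Finset.range_mono (Nat.le_add_left T n))
    _ = ∑ t ∈ Finset.range n, ∫⁻ v, g (lagState m (x, v) t) ∂noise +
          ∑ t ∈ Finset.range T, ∫⁻ v, g (lagState m (x, v) (n + t)) ∂noise :=
        Finset.sum_range_add _ n T
    _ ≤ ∑ _t ∈ Finset.range n, B + ∑ _t ∈ Finset.range T, ∫⁻ y, g y := by
        gcongr with t _ t _
        exacts [hburn t, lintegral_lagState_le_lintegral hm (Nat.le_add_right n t) hg x]
    _ = n * B + T * ∫⁻ y, g y := by simp

end Occupation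

/-! ### Assouad's lemma -/

section Averaging

variable {α ι : Type*}

theorem card_mul_half_le_sum [Fintype α] (e : Equiv.Perm α) {a : α → ℝ≥0∞} {ε : ℝ≥0∞}
    (h : ∀ w, ε ≤ a w + a (e w)) : Fintype.card α * (ε / 2) ≤ ∑ w, a w := by
  have hdouble : Fintype.card α * ε ≤ 2 * ∑ w, a w := by
    calc (Fintype.card α : ℝ≥0∞) * ε = ∑ _w : α, ε := by simp
      _ ≤ ∑ w, (a w + a (e w)) := Finset.sum_le_sum fun w _ => h w
      _ = 2 * ∑ w, a w := by rw [Finset.sum_add_distrib, Equiv.sum_comp e a, two_mul]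
  rw [← mul_div_assoc]
  exact ENNReal.div_le_of_le_mul' hdouble

theorem exists_half_mul_sum_measure_le [Finite α] [Nonempty α] [Fintype ι] {X : Type*}
    [MeasurableSpace X] {μ : Measure X} (e : ι → Equiv.Perm α) {R : α → X → ℝ≥0∞}
    (hR : ∀ w, Measurable (R w)) {I : ι → Set X} (hI : ∀ u, MeasurableSet (I u))
    (hdisj : Pairwise (Function.onFun Disjoint I)) {s : Set X} (hIs : ∀ u, I u ⊆ s) {ε : ℝ≥0∞}
    (h : ∀ w u, ∀ x ∈ I u, ε ≤ R w x + R (e u w) x) :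
    ∃ w, ε / 2 * ∑ u, μ (I u) ≤ ∫⁻ x in s, R w x ∂μ := by
  cases nonempty_fintype α
  obtain ⟨w, -, hw⟩ := ENNReal.exists_le_of_sum_le (s := (Finset.univ : Finset α))
    (f := fun _ => ε / 2 * ∑ u, μ (I u)) (g := fun w => ∫⁻ x in s, R w x ∂μ)
    Finset.univ_nonempty <| by
      calc ∑ _w : α, ε / 2 * ∑ u, μ (I u)
          = ∑ u, ∫⁻ _ in I u, Fintype.card α * (ε / 2) ∂μ := by
            simp [Finset.mul_sum, mul_assoc]
        _ ≤ ∑ u, ∫⁻ x in I u, ∑ w, R w x ∂μ := Finset.sum_le_sum fun u _ =>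
            setLIntegral_mono' (hI u) fun x hx => card_mul_half_le_sum (e u) (h · u x hx)
        _ = ∫⁻ x in ⋃ u, I u, ∑ w, R w x ∂μ := by
            rw [lintegral_iUnion hI hdisj, tsum_fintype]
        _ ≤ ∫⁻ x in s, ∑ w, R w x ∂μ := lintegral_mono_set (Set.iUnion_subset hIs)
        _ = ∑ w, ∫⁻ x in s, R w x ∂μ := lintegral_finsetSum _ fun w _ => hR w
  exact ⟨w, hw⟩

end Averaging

section Assouad

variable {n : ℕ} {ν : Measure (Fin n → ℝ)}

instance isProbabilityMeasure_modelMeasure [IsProbabilityMeasure ν] :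
    IsProbabilityMeasure (modelMeasure ν) := by
  unfold modelMeasure
  infer_instance

theorem lintegral_modelMeasure [SFinite ν] {F : Sample n → ℝ≥0∞} (hF : Measurable F) :
    ∫⁻ ω, F ω ∂modelMeasure ν = ∫⁻ x, ∫⁻ v, F (x, v) ∂noise ∂ν :=
  lintegral_prod _ hF.aemeasurable

variable [IsProbabilityMeasure ν]

theorem le_lintegral_modelMeasure {F : Sample n → ℝ≥0∞} (hF : Measurable F) {C : ℝ≥0∞}
    (h : ∀ x, C ≤ ∫⁻ v, F (x, v) ∂noise) : C ≤ ∫⁻ ω, F ω ∂modelMeasure ν := by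
  rw [lintegral_modelMeasure hF]
  calc C = ∫⁻ _, C ∂ν := by simp
    _ ≤ _ := lintegral_mono h

theorem half_mul_le_average {T : ℕ} (hT : 0 < T) (hnT : 2 * n ≤ T) {a : ℕ → ℝ≥0∞} {C : ℝ≥0∞}
    (h : ∀ t, n ≤ t → C ≤ a t) :
    1 / 2 * C ≤ ENNReal.ofReal (1 / T) * ∑ t ∈ Finset.range T, a t := by
  have hsum : ((T - n : ℕ) : ℝ≥0∞) * C ≤ ∑ t ∈ Finset.range T, a t := by
    calc ((T - n : ℕ) : ℝ≥0∞) * C = ∑ _t ∈ Finset.Ico n T, C := by simp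
      _ ≤ ∑ t ∈ Finset.Ico n T, a t :=
        Finset.sum_le_sum fun t ht => h t (Finset.mem_Ico.1 ht).1
      _ ≤ ∑ t ∈ Finset.range T, a t := Finset.sum_le_sum_of_subset fun t ht =>
        Finset.mem_range.2 (Finset.mem_Ico.1 ht).2
  have hhalf : (1 / 2 : ℝ≥0∞) ≤ ENNReal.ofReal (1 / T) * ((T - n : ℕ) : ℝ≥0∞) := by
    have hT0 : (0 : ℝ) < T := by exact_mod_cast hT
    have hnT' : (2 : ℝ) * n ≤ T := by exact_mod_cast hnT
    rw [← ENNReal.ofReal_natCast, ← ENNReal.ofReal_mul (by positivity), ← ENNReal.ofReal_one,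
      ← ENNReal.ofReal_ofNat 2, ← ENNReal.ofReal_div_of_pos (by norm_num)]
    refine ENNReal.ofReal_le_ofReal ?_
    rw [Nat.cast_sub (by omega), div_mul_eq_mul_div, one_mul, le_div_iff₀ hT0]
    linarith
  calc 1 / 2 * C ≤ ENNReal.ofReal (1 / T) * ((T - n : ℕ) : ℝ≥0∞) * C := by gcongr
    _ ≤ _ := by
      rw [mul_assoc]
      gcongr

/-- The risk `E[(f̂(x) - m(x))²]` of the estimator `f` at the point `x`. -/
def pointRisk (ν : Measure (Fin n → ℝ)) (m : (Fin n → ℝ) → ℝ) (T : ℕ)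
    (f : (Fin T → ℝ × (Fin n → ℝ)) → (Fin n → ℝ) → ℝ) (x : Fin n → ℝ) : ℝ≥0∞ :=
  ∫⁻ ω, edist (f (observations m T ω) x) (m x) ^ 2 ∂modelMeasure ν

variable {T : ℕ} {f : (Fin T → ℝ × (Fin n → ℝ)) → (Fin n → ℝ) → ℝ}

theorem measurable_pointRisk {m : (Fin n → ℝ) → ℝ} (hm : Measurable m) (hf : f ∈ estimators n T) :
    Measurable (pointRisk ν m T f) := by
  have hf' : Measurable (Function.uncurry f) := hf
  have hobs := measurable_observations hm T
  exact Measurable.lintegral_prod_left' (f := fun p : Sample n × (Fin n → ℝ) =>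
    edist (f (observations m T p.1) p.2) (m p.2) ^ 2) (by fun_prop)

theorem measurableSet_cube (n : ℕ) (l u : ℝ) : MeasurableSet (cube n l u) := measurableSet_Icc

theorem measurable_target {m : (Fin n → ℝ) → ℝ} (hm : Measurable m) : Measurable (target m) :=
  hm.indicator (measurableSet_cube n 0 1)

theorem risk_eq_lintegral_average {m : (Fin n → ℝ) → ℝ} (hm : Measurable m)
    (hf : f ∈ estimators n T) :
    risk ν m T f = ∫⁻ ω, ENNReal.ofReal (1 / T) * ∑ t ∈ Finset.range T,
      ∫⁻ ω', edist (f (observations m T ω) (lagState m ω' t)) (target m (lagState m ω' t)) ^ 2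
        ∂modelMeasure ν ∂modelMeasure ν := by
  have hf' : Measurable (Function.uncurry f) := hf
  have htarget := measurable_target hm
  have hobs := measurable_observations hm T
  have hstate := measurable_lagState hm
  rw [risk, lintegral_prod _ (Measurable.aemeasurable (by fun_prop))]
  refine lintegral_congr fun ω => ?_
  rw [← lintegral_finsetSum _ fun t _ => by fun_prop,
    ← lintegral_const_mul' _ _ ENNReal.ofReal_ne_top]
  refine lintegral_congr fun ω' => ?_
  rw [ENNReal.ofReal_mul (by positivity), ENNReal.ofReal_sum_of_nonneg fun _ _ => sq_nonneg _]
  simp only [ofReal_sub_sq]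

theorem setLIntegral_pointRisk_le_risk {m : (Fin n → ℝ) → ℝ} (hm : Measurable m) {K : ℝ}
    (hK : ∀ x, |m x| ≤ K) (hT : 0 < T) (hnT : 2 * n ≤ T) (hf : f ∈ estimators n T) :
    1 / 2 * gaussianPDF 0 1 (K + 1) ^ n * ∫⁻ x in cube n 0 1, pointRisk ν m T f x ≤
      risk ν m T f := by
  have hf' : Measurable (Function.uncurry f) := hf
  have htarget := measurable_target hm
  have hobs := measurable_observations hm T
  have hloss : Measurable fun p : Sample n × (Fin n → ℝ) =>
      edist (f (observations m T p.1) p.2) (m p.2) ^ 2 := by fun_prop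
  have hswap : ∫⁻ x in cube n 0 1, pointRisk ν m T f x = ∫⁻ ω, (∫⁻ x in cube n 0 1,
      edist (f (observations m T ω) x) (m x) ^ 2) ∂modelMeasure ν :=
    lintegral_lintegral_swap (hloss.comp measurable_swap).aemeasurable
  rw [hswap, risk_eq_lintegral_average hm hf, ← lintegral_const_mul _ hloss.lintegral_prod_right']
  refine lintegral_mono fun ω => ?_
  let g (x : Fin n → ℝ) : ℝ≥0∞ := edist (f (observations m T ω) x) (target m x) ^ 2
  have hg : Measurable g := by fun_prop
  have hcube : ∫⁻ x in cube n 0 1, edist (f (observations m T ω) x) (m x) ^ 2 =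
      ∫⁻ x in cube n 0 1, g x :=
    setLIntegral_congr_fun (measurableSet_cube n 0 1) fun x hx => by
      simp only [g, target, Set.indicator_of_mem hx]
  simp only [hcube, mul_assoc]
  exact half_mul_le_average hT hnT fun t ht =>
    le_lintegral_modelMeasure (hg.comp (measurable_lagState hm t)) fun x =>
      setLIntegral_cube_le_lintegral_lagState hm hK ht hg x

theorem edist_sq_div_four_le_pointRisk_add {m₀ m₁ : (Fin n → ℝ) → ℝ} (hm₀ : Measurable m₀)
    (hm₁ : Measurable m₁) {B : ℝ≥0∞} (hB : ∀ y, edist (m₀ y) (m₁ y) ^ 2 ≤ B)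
    (hclose : n * B + T * ∫⁻ y, edist (m₀ y) (m₁ y) ^ 2 ≤ 2) (hf : f ∈ estimators n T)
    (x : Fin n → ℝ) :
    edist (m₀ x) (m₁ x) ^ 2 / 4 ≤ pointRisk ν m₀ T f x + pointRisk ν m₁ T f x := by
  have hf' : Measurable (Function.uncurry f) := hf
  have hobs₀ := measurable_observations hm₀ T
  have hobs₁ := measurable_observations hm₁ T
  rw [pointRisk, pointRisk, ← lintegral_add_left (by fun_prop)]
  refine le_lintegral_modelMeasure (by fun_prop) fun x₀ => ?_
  rw [lintegral_add_left (by fun_prop)]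
  refine edist_sq_div_four_le hm₀ hm₁ (h := fun o => f o x) ?_ (by fun_prop) _ _
  exact (lintegral_sum_lagState_le (g := fun y => edist (m₀ y) (m₁ y) ^ 2)
    (measurable_midpoint hm₀ hm₁) (by fun_prop) hB T x₀).trans hclose

theorem le_minimaxRisk_of_perm {α ι : Type*} [Finite α] [Nonempty α] [Fintype ι]
    {M : Set ((Fin n → ℝ) → ℝ)} (hT : 0 < T) (hnT : 2 * n ≤ T) {m : α → (Fin n → ℝ) → ℝ}
    (hmM : ∀ w, m w ∈ M) (hm : ∀ w, Measurable (m w)) {K : ℝ} (hK : ∀ w x, |m w x| ≤ K)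
    (e : ι → Equiv.Perm α) {I : ι → Set (Fin n → ℝ)} (hI : ∀ u, MeasurableSet (I u))
    (hIc : ∀ u, I u ⊆ cube n 0 1) (hdisj : Pairwise (Function.onFun Disjoint I)) {ε B : ℝ≥0∞}
    (hsep : ∀ w u, ∀ x ∈ I u, ε ≤ edist (m w x) (m (e u w) x) ^ 2)
    (hB : ∀ w u y, edist (m w y) (m (e u w) y) ^ 2 ≤ B)
    (hclose : ∀ w u, n * B + T * ∫⁻ y, edist (m w y) (m (e u w) y) ^ 2 ≤ 2) :
    1 / 2 * gaussianPDF 0 1 (K + 1) ^ n * (ε / 4 / 2 * ∑ u, volume (I u)) ≤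
      minimaxRisk ν M T := by
  refine le_iInf₂ fun f hf => ?_
  obtain ⟨w, hw⟩ := exists_half_mul_sum_measure_le (μ := volume) e
    (fun w => measurable_pointRisk (ν := ν) (hm w) hf) hI hdisj hIc (ε := ε / 4)
    fun w u x hx => (ENNReal.div_le_div_right (hsep w u x hx) 4).trans
      (edist_sq_div_four_le_pointRisk_add (hm w) (hm (e u w)) (hB w u) (hclose w u) hf x)
  calc _ ≤ 1 / 2 * gaussianPDF 0 1 (K + 1) ^ n * ∫⁻ x in cube n 0 1, pointRisk ν (m w) T f x := by
        gcongr
    _ ≤ risk ν (m w) T f := setLIntegral_pointRisk_le_risk (hm w) (hK w) hT hnT hf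
    _ ≤ ⨆ m ∈ M, risk ν m T f := le_iSup₂ (f := fun m _ => risk ν m T f) (m w) (hmM w)

end Assouad

/-! ### Bounds on Hölder norms -/

section Holder

variable {p : ℕ} {l u : ℝ}

theorem mem_cube {x : Fin p → ℝ} : x ∈ cube p l u ↔ ∀ i, l ≤ x i ∧ x i ≤ u := by
  simp only [cube, Set.mem_Icc, Pi.le_def, forall_and]

theorem uniqueDiffOn_cube (h : l < u) : UniqueDiffOn ℝ (cube p l u) := by
  rw [cube, ← Set.pi_univ_Icc]
  exact UniqueDiffOn.univ_pi fun _ => uniqueDiffOn_Icc h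

theorem convex_cube (p : ℕ) (l u : ℝ) : Convex ℝ (cube p l u) := convex_Icc _ _

theorem multiDeriv_of_sum_eq_zero {s : Set (Fin p → ℝ)} {α : Fin p → ℕ} (hα : ∑ i, α i = 0)
    (f : (Fin p → ℝ) → ℝ) (x : Fin p → ℝ) : multiDeriv s α f x = f x := by
  have h (k : ℕ) (hk : k = 0) (e : Fin k → Fin p → ℝ) :
      iteratedFDerivWithin ℝ k f s x e = f x := by
    subst hk
    exact iteratedFDerivWithin_zero_apply e
  exact h _ hα _

theorem norm_apply_single_le {k : ℕ} (L : ContinuousMultilinearMap ℝ (fun _ : Fin k => Fin p → ℝ) ℝ)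
    (e : Fin k → Fin p) : ‖L fun j => Pi.single (e j) (1 : ℝ)‖ ≤ ‖L‖ := by
  refine (L.le_opNorm _).trans_eq ?_
  simp [Pi.norm_single]

theorem norm_multiDeriv_le {s : Set (Fin p → ℝ)} (hs : UniqueDiffOn ℝ s) {α : Fin p → ℕ}
    {f : (Fin p → ℝ) → ℝ} (hf : ContDiff ℝ (∑ i, α i : ℕ) f) {x : Fin p → ℝ} (hx : x ∈ s) :
    ‖multiDeriv s α f x‖ ≤ ‖iteratedFDeriv ℝ (∑ i, α i) f x‖ := by
  rw [multiDeriv, iteratedFDerivWithin_eq_iteratedFDeriv hs hf.contDiffAt hx]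
  exact norm_apply_single_le _ _

theorem norm_multiDeriv_sub_le {s : Set (Fin p → ℝ)} (hs : UniqueDiffOn ℝ s) {α : Fin p → ℕ}
    {f : (Fin p → ℝ) → ℝ} (hf : ContDiff ℝ (∑ i, α i : ℕ) f) {x y : Fin p → ℝ} (hx : x ∈ s)
    (hy : y ∈ s) :
    ‖multiDeriv s α f x - multiDeriv s α f y‖ ≤
      ‖iteratedFDeriv ℝ (∑ i, α i) f x - iteratedFDeriv ℝ (∑ i, α i) f y‖ := by
  rw [multiDeriv, multiDeriv, iteratedFDerivWithin_eq_iteratedFDeriv hs hf.contDiffAt hx,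
    iteratedFDerivWithin_eq_iteratedFDeriv hs hf.contDiffAt hy, ← sub_apply]
  exact norm_apply_single_le _ _

/-- The number of summands of the Hölder norm of order `β`. -/
def holderCount (p : ℕ) (β : ℝ) : ℕ :=
  ∑ k ∈ Finset.range ⌈β⌉₊, (multiIndices p k).card + (multiIndices p ⌊β⌋₊).card

theorem holderNorm_le_of_norm_multiDeriv_le {β C : ℝ} (hβ : 0 ≤ β) {f : (Fin p → ℝ) → ℝ}
    (hderiv : ∀ α : Fin p → ℕ, ((∑ i, α i : ℕ) : ℝ) < β → ∀ x ∈ cube p l u,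
      ‖multiDeriv (cube p l u) α f x‖ ≤ C)
    (hseminorm : ∀ α : Fin p → ℕ, ∑ i, α i = ⌊β⌋₊ → ∀ x ∈ cube p l u, ∀ y ∈ cube p l u,
      ‖multiDeriv (cube p l u) α f x - multiDeriv (cube p l u) α f y‖ ≤
        C * dist x y ^ (β - ⌊β⌋₊)) :
    holderNorm p l u β f ≤ ENNReal.ofReal (holderCount p β * C) := by
  have hsum {k : ℕ} {α : Fin p → ℕ} (hα : α ∈ multiIndices p k) : ∑ i, α i = k :=
    (Finset.mem_piAntidiag.1 hα).1
  calc holderNorm p l u β f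
      ≤ ∑ k ∈ Finset.range ⌈β⌉₊, ∑ _α ∈ multiIndices p k, ENNReal.ofReal C +
          ∑ _α ∈ multiIndices p ⌊β⌋₊, ENNReal.ofReal C := by
        refine add_le_add (Finset.sum_le_sum fun k hk => Finset.sum_le_sum fun α hα => ?_)
          (Finset.sum_le_sum fun α hα => ?_)
        · refine iSup₂_le fun x hx => ?_
          rw [← ofReal_norm]
          refine ENNReal.ofReal_le_ofReal (hderiv α ?_ x hx)
          rw [hsum hα]
          exact Nat.lt_ceil.1 (Finset.mem_range.1 hk)
        · refine iSup₂_le fun x hx => iSup₂_le fun y hy => iSup_le fun _ =>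
            ENNReal.div_le_of_le_mul ?_
          rw [← ofReal_norm, edist_dist, ENNReal.ofReal_rpow_of_nonneg dist_nonneg
            (sub_nonneg.2 (Nat.floor_le hβ)), ← ENNReal.ofReal_mul' (by positivity)]
          exact ENNReal.ofReal_le_ofReal (hseminorm α (hsum hα) x hx y hy)
    _ = ENNReal.ofReal (holderCount p β * C) := by
        rw [ENNReal.ofReal_mul (Nat.cast_nonneg _), ENNReal.ofReal_natCast, holderCount]
        simp only [Finset.sum_const, nsmul_eq_mul, ← Finset.sum_mul, Nat.cast_add, Nat.cast_sum,
          add_mul]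

theorem min_two_mul_le_mul_rpow {a s : ℝ} (ha : 0 ≤ a) (hs : 0 ≤ s) (hs1 : s ≤ 1) :
    min 2 a ≤ 2 * a ^ s := by
  rcases le_or_gt a 1 with h | h
  · have hle : a ≤ a ^ s := by
      rcases ha.eq_or_lt with rfl | ha
      · positivity
      · simpa using Real.rpow_le_rpow_of_exponent_ge ha h hs1
    exact (min_le_right _ _).trans (by linarith [Real.rpow_nonneg ha s])
  · exact (min_le_left _ _).trans (by linarith [Real.one_le_rpow h.le hs])

theorem norm_sub_le_mul_min {E F : Type*} [NormedAddCommGroup E] [NormedSpace ℝ E]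
    [NormedAddCommGroup F] [NormedSpace ℝ F] {g : E → F} (hg : Differentiable ℝ g) {s : Set E}
    (hs : Convex ℝ s) {B N : ℝ} (hB : 0 ≤ B) (hbd : ∀ x ∈ s, ‖g x‖ ≤ B)
    (hderiv : ∀ x ∈ s, ‖fderiv ℝ g x‖ ≤ B * N) {x y : E} (hx : x ∈ s) (hy : y ∈ s) :
    ‖g x - g y‖ ≤ B * min 2 (N * dist x y) := by
  rw [mul_min_of_nonneg _ _ hB]
  refine le_min ?_ ?_
  · linarith [norm_sub_le (g x) (g y), hbd x hx, hbd y hy]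
  · rw [dist_eq_norm, ← mul_assoc]
    exact hs.norm_image_sub_le_of_norm_fderiv_le (fun z _ => hg z) hderiv hy hx

theorem norm_iteratedFDeriv_sub_le {E F : Type*} [NormedAddCommGroup E] [NormedSpace ℝ E]
    [NormedAddCommGroup F] [NormedSpace ℝ F] {β C N : ℝ} (hβ : 0 ≤ β) (hN : 0 < N) (hC : 0 ≤ C)
    {f : E → F} (hf : ContDiff ℝ (⌊β⌋₊ + 1 : ℕ) f) {s : Set E} (hs : Convex ℝ s)
    (hbd : ∀ k ≤ ⌊β⌋₊ + 1, ∀ x ∈ s, ‖iteratedFDeriv ℝ k f x‖ ≤ C * N ^ ((k : ℝ) - β)) {x y : E}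
    (hx : x ∈ s) (hy : y ∈ s) :
    ‖iteratedFDeriv ℝ ⌊β⌋₊ f x - iteratedFDeriv ℝ ⌊β⌋₊ f y‖ ≤
      2 * C * dist x y ^ (β - ⌊β⌋₊) := by
  have hs0 : 0 ≤ β - ⌊β⌋₊ := sub_nonneg.2 (Nat.floor_le hβ)
  have hs1 : β - ⌊β⌋₊ ≤ 1 := by linarith [Nat.lt_floor_add_one β]
  have hderiv : ∀ z ∈ s, ‖fderiv ℝ (iteratedFDeriv ℝ ⌊β⌋₊ f) z‖ ≤
      C * N ^ ((⌊β⌋₊ : ℝ) - β) * N := fun z hz => by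
    rw [norm_fderiv_iteratedFDeriv, mul_assoc, ← Real.rpow_add_one hN.ne']
    refine (hbd _ le_rfl z hz).trans_eq ?_
    push_cast
    ring_nf
  calc _ ≤ C * N ^ ((⌊β⌋₊ : ℝ) - β) * min 2 (N * dist x y) :=
        norm_sub_le_mul_min
          (hf.differentiable_iteratedFDeriv (by exact_mod_cast Nat.lt_succ_self _))
          hs (by positivity) (hbd _ (Nat.le_succ _)) hderiv hx hy
    _ ≤ C * N ^ ((⌊β⌋₊ : ℝ) - β) * (2 * (N * dist x y) ^ (β - ⌊β⌋₊)) := by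
        gcongr
        exact min_two_mul_le_mul_rpow (by positivity) hs0 hs1
    _ = 2 * C * (N ^ ((⌊β⌋₊ : ℝ) - β) * N ^ (β - ⌊β⌋₊)) * dist x y ^ (β - ⌊β⌋₊) := by
        rw [Real.mul_rpow hN.le dist_nonneg]
        ring
    _ = 2 * C * dist x y ^ (β - ⌊β⌋₊) := by
        rw [← Real.rpow_add hN, sub_add_sub_cancel, sub_self, Real.rpow_zero, mul_one]

theorem holderNorm_le_of_norm_iteratedFDeriv_le (hlu : l < u) {β C N : ℝ} (hβ : 0 ≤ β)
    (hN : 1 ≤ N) (hC : 0 ≤ C) {f : (Fin p → ℝ) → ℝ} (hf : ContDiff ℝ (⌊β⌋₊ + 1 : ℕ) f)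
    (hbd : ∀ k ≤ ⌊β⌋₊ + 1, ∀ x ∈ cube p l u,
      ‖iteratedFDeriv ℝ k f x‖ ≤ C * N ^ ((k : ℝ) - β)) :
    holderNorm p l u β f ≤ ENNReal.ofReal (holderCount p β * (2 * C)) := by
  have hcube := uniqueDiffOn_cube (p := p) hlu
  refine holderNorm_le_of_norm_multiDeriv_le hβ (fun α hα x hx => ?_) fun α hα x hx y hy => ?_
  · have hle : ∑ i, α i ≤ ⌊β⌋₊ + 1 := (Nat.le_floor hα.le).trans (Nat.le_succ _)
    calc _ ≤ ‖iteratedFDeriv ℝ (∑ i, α i) f x‖ :=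
          norm_multiDeriv_le hcube (hf.of_le (by exact_mod_cast hle)) hx
      _ ≤ C * N ^ (((∑ i, α i : ℕ) : ℝ) - β) := hbd _ hle x hx
      _ ≤ C * 1 := by
        gcongr
        exact Real.rpow_le_one_of_one_le_of_nonpos hN (by linarith)
      _ ≤ 2 * C := by linarith
  · have hf' : ContDiff ℝ (∑ i, α i : ℕ) f :=
      hf.of_le (by exact_mod_cast hα.trans_le (Nat.le_succ _))
    refine (norm_multiDeriv_sub_le hcube hf' hx hy).trans ?_
    rw [hα]
    exact norm_iteratedFDeriv_sub_le hβ (by linarith) hC hf (convex_cube p l u) hbd hx hy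

end Holder

/-! ### Coordinates and their powers -/

section Coord

variable {p : ℕ}

/-- The coordinate with index `a`, or `0` if there is none; the layers of a composition, which
have different widths, then share the same indices. -/
def coord (p a : ℕ) : (Fin p → ℝ) →L[ℝ] ℝ :=
  if h : a < p then ContinuousLinearMap.proj ⟨a, h⟩ else 0

theorem coord_of_lt {a : ℕ} (h : a < p) (x : Fin p → ℝ) : coord p a x = x ⟨a, h⟩ := by
  simp [coord, h]

theorem norm_coord_apply_le (a : ℕ) (x : Fin p → ℝ) : ‖coord p a x‖ ≤ ‖x‖ := by
  unfold coord
  split_ifs with h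
  · exact norm_le_pi_norm x _
  · simp

theorem norm_coord_le (p a : ℕ) : ‖coord p a‖ ≤ 1 :=
  ContinuousLinearMap.opNorm_le_bound _ zero_le_one fun x =>
    (norm_coord_apply_le a x).trans_eq (one_mul _).symm

theorem coord_mem_Icc (a : ℕ) {x : Fin p → ℝ} (hx : x ∈ cube p 0 1) :
    coord p a x ∈ Set.Icc (0 : ℝ) 1 := by
  unfold coord
  split_ifs with h
  · exact mem_cube.1 hx _
  · simp

theorem dependsOnAtMost_coord {r : ℕ} (hr : 1 ≤ r) (l u : ℝ) (a : ℕ) (F : ℝ → ℝ) :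
    DependsOnAtMost p r l u fun x => F (coord p a x) := by
  by_cases h : a < p
  · refine ⟨{⟨a, h⟩}, by simpa using hr, fun x _ y _ hxy => ?_⟩
    simp only [coord_of_lt h, hxy _ (Finset.mem_singleton_self _)]
  · exact ⟨∅, by simp, fun x _ y _ _ => by simp [coord, h]⟩

theorem norm_iteratedFDeriv_coord_le (a k : ℕ) {x : Fin p → ℝ} (hx : x ∈ cube p 0 1) :
    ‖iteratedFDeriv ℝ k (coord p a) x‖ ≤ 1 := by
  match k with
  | 0 =>
    obtain ⟨h0, h1⟩ := coord_mem_Icc a hx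
    rwa [norm_iteratedFDeriv_zero, Real.norm_eq_abs, abs_of_nonneg h0]
  | 1 =>
    rw [← norm_iteratedFDeriv_fderiv, norm_iteratedFDeriv_zero, ContinuousLinearMap.fderiv]
    exact norm_coord_le p a
  | k + 2 =>
    have hconst : fderiv ℝ (coord p a) = fun _ => coord p a :=
      funext fun _ => ContinuousLinearMap.fderiv _
    rw [← norm_iteratedFDeriv_fderiv, hconst, iteratedFDeriv_const_of_ne (Nat.succ_ne_zero k)]
    simp

theorem coord_mem_holderClass {r : ℕ} (hr : 1 ≤ r) {β A : ℝ} (hβ : 0 ≤ β)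
    (hA : holderCount p β * 2 ≤ A) (a : ℕ) :
    (fun x => coord p a x) ∈ holderClass p r 0 1 β A := by
  refine ⟨dependsOnAtMost_coord hr 0 1 a id, (coord p a).contDiff.contDiffOn, ?_⟩
  refine (holderNorm_le_of_norm_iteratedFDeriv_le zero_lt_one (C := 1) (N := 1) hβ le_rfl
    zero_le_one (coord p a).contDiff fun k _ x hx => ?_).trans
    (ENNReal.ofReal_le_ofReal (by rwa [mul_one]))
  simpa using norm_iteratedFDeriv_coord_le a k hx

theorem abs_rpow_sub_rpow_le {x y s : ℝ} (hx : 0 ≤ x) (hy : 0 ≤ y) (hs : 0 ≤ s) (hs1 : s ≤ 1) :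
    |x ^ s - y ^ s| ≤ |x - y| ^ s := by
  wlog h : y ≤ x generalizing x y
  · rw [abs_sub_comm, abs_sub_comm x]
    exact this hy hx (le_of_not_ge h)
  rw [abs_of_nonneg (sub_nonneg.2 h),
    abs_of_nonneg (sub_nonneg.2 (Real.rpow_le_rpow hy h hs))]
  have hsub := Real.rpow_add_le_add_rpow hy (sub_nonneg.2 h) hs hs1
  rw [add_sub_cancel] at hsub
  linarith

theorem coord_rpow_mem_holderClass_of_lt_one {r : ℕ} (hr : 1 ≤ r) {β A : ℝ} (hβ : 0 ≤ β)
    (hβ1 : β < 1) (hA : holderCount p β ≤ A) (a : ℕ) :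
    (fun x => coord p a x ^ β) ∈ holderClass p r 0 1 β A := by
  have hfloor : ⌊β⌋₊ = 0 := Nat.floor_eq_zero.2 hβ1
  refine ⟨dependsOnAtMost_coord hr 0 1 a fun z => z ^ β, ?_, ?_⟩
  · rw [hfloor]
    exact contDiffOn_zero.2 ((coord p a).continuous.rpow_const fun _ => Or.inr hβ).continuousOn
  refine (holderNorm_le_of_norm_multiDeriv_le (C := 1) hβ (fun α hα x hx => ?_)
    fun α hα x hx y hy => ?_).trans (ENNReal.ofReal_le_ofReal (by rwa [mul_one]))
  · have hα0 : ∑ i, α i = 0 := by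
      have : ((∑ i, α i : ℕ) : ℝ) < (1 : ℕ) := by exact_mod_cast hα.trans hβ1
      exact Nat.lt_one_iff.1 (Nat.cast_lt.1 this)
    obtain ⟨h0, h1⟩ := coord_mem_Icc a hx
    rw [multiDeriv_of_sum_eq_zero hα0, Real.norm_eq_abs, abs_of_nonneg (Real.rpow_nonneg h0 _)]
    exact Real.rpow_le_one h0 h1 hβ
  · rw [hfloor] at hα ⊢
    rw [multiDeriv_of_sum_eq_zero hα, multiDeriv_of_sum_eq_zero hα, Nat.cast_zero, sub_zero,
      one_mul, Real.norm_eq_abs]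
    refine (abs_rpow_sub_rpow_le (coord_mem_Icc a hx).1 (coord_mem_Icc a hy).1 hβ hβ1.le).trans ?_
    refine Real.rpow_le_rpow (abs_nonneg _) ?_ hβ
    rw [← map_sub, dist_eq_norm]
    exact norm_coord_apply_le a _

theorem coord_rpow_mem_holderClass {r : ℕ} (hr : 1 ≤ r) {β A : ℝ} (hβ : 0 ≤ β)
    (hA : holderCount p β * 2 ≤ A) (a : ℕ) :
    (fun x => coord p a x ^ min β 1) ∈ holderClass p r 0 1 β A := by
  rcases le_or_gt 1 β with h1 | h1
  · simpa only [min_eq_right h1, Real.rpow_one] using coord_mem_holderClass hr hβ hA a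
  · rw [min_eq_left h1.le]
    exact coord_rpow_mem_holderClass_of_lt_one hr hβ h1
      (by linarith [Nat.cast_nonneg (α := ℝ) (holderCount p β)]) a

end Coord

/-! ### Sums of bumps on a grid -/

section Bumps

variable {s N : ℕ}

theorem sum_mem_of_subsingleton_support {ι E : Type*} [Fintype ι] [AddCommMonoid E] {S : Set E}
    (h0 : 0 ∈ S) {f : ι → E} (hf : (Function.support f).Subsingleton) (hS : ∀ i, f i ∈ S) :
    ∑ i, f i ∈ S := by
  by_cases h : ∃ i, f i ≠ 0
  · obtain ⟨i, hi⟩ := h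
    rw [Fintype.sum_eq_single i fun j hj => of_not_not fun hj0 => hj (hf hj0 hi)]
    exact hS i
  · push Not at h
    rwa [Fintype.sum_eq_zero f h]

/-- A smooth bump supported in the open unit cube; it is `1` on `[1/4, 3/4]^s`. -/
def unitBump (s : ℕ) : ContDiffBump (fun _ : Fin s => (1 / 2 : ℝ)) :=
  ⟨1 / 4, 3 / 8, by norm_num, by norm_num⟩

theorem tsupport_unitBump_subset (s : ℕ) :
    tsupport (unitBump s) ⊆ Set.univ.pi fun _ => Set.Ioo 0 1 := by
  intro z hz a _
  rw [ContDiffBump.tsupport_eq] at hz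
  have ha : |z a - 1 / 2| ≤ 3 / 8 := (dist_le_pi_dist z _ a).trans hz
  rw [abs_le] at ha
  constructor <;> linarith

theorem unitBump_eq_one {z : Fin s → ℝ} (hz : z ∈ cube s (1 / 4) (3 / 4)) : unitBump s z = 1 := by
  refine (unitBump s).one_of_mem_closedBall
    ((dist_pi_le_iff (unitBump s).rIn_pos.le).2 fun a => ?_)
  change |z a - 1 / 2| ≤ 1 / 4
  rw [abs_le]
  constructor <;> linarith [mem_cube.1 hz a]

theorem exists_norm_iteratedFDeriv_unitBump_le (s n : ℕ) :
    ∃ C : ℝ, ∀ k ≤ n, ∀ z, ‖iteratedFDeriv ℝ k (unitBump s) z‖ ≤ C := by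
  have hk (k : ℕ) : ∃ C : ℝ, ∀ z, ‖iteratedFDeriv ℝ k (unitBump s) z‖ ≤ C :=
    ((unitBump s).hasCompactSupport.iteratedFDeriv k).exists_bound_of_continuous
      (((unitBump s).contDiff (n := k)).continuous_iteratedFDeriv le_rfl)
  choose C hC using hk
  exact ⟨(Finset.range (n + 1)).sup' Finset.nonempty_range_add_one C, fun k hkn z =>
    (hC k z).trans (Finset.le_sup' C (Finset.mem_range_succ_iff.2 hkn))⟩

/-- The lower corner of the grid cell `u`, in the units of the grid. -/
def corner (u : Fin s → Fin N) : Fin s → ℝ := fun a => (u a : ℝ)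

theorem eq_of_sub_corner_mem {u u' : Fin s → Fin N} {z : Fin s → ℝ}
    (h : z - corner u ∈ Set.univ.pi fun _ => Set.Ioo 0 1)
    (h' : z - corner u' ∈ Set.univ.pi fun _ => Set.Ioo 0 1) : u = u' := by
  funext a
  obtain ⟨h0, h1⟩ : 0 < z a - (u a : ℕ) ∧ z a - (u a : ℕ) < 1 := h a trivial
  obtain ⟨h0', h1'⟩ : 0 < z a - (u' a : ℕ) ∧ z a - (u' a : ℕ) < 1 := h' a trivial
  have hlt : ((u a : ℕ) : ℝ) < (u' a + 1 : ℕ) := by push_cast; linarith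
  have hlt' : ((u' a : ℕ) : ℝ) < (u a + 1 : ℕ) := by push_cast; linarith
  rw [Nat.cast_lt] at hlt hlt'
  exact Fin.ext (by omega)

/-- The bump on the cell `u`, if `w` selects this cell. -/
def cellBump (w : (Fin s → Fin N) → Bool) (u : Fin s → Fin N) (z : Fin s → ℝ) : ℝ :=
  if w u then unitBump s (z - corner u) else 0

theorem contDiff_cellBump (w : (Fin s → Fin N) → Bool) (u : Fin s → Fin N) (k : ℕ) :
    ContDiff ℝ k (cellBump w u) := by
  unfold cellBump
  split_ifs
  · exact (unitBump s).contDiff.comp (contDiff_id.sub contDiff_const)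
  · exact contDiff_const

theorem cellBump_mem_Icc (w : (Fin s → Fin N) → Bool) (u : Fin s → Fin N) (z : Fin s → ℝ) :
    cellBump w u z ∈ Set.Icc (0 : ℝ) 1 := by
  unfold cellBump
  split_ifs
  · exact ⟨(unitBump s).nonneg, (unitBump s).le_one⟩
  · simp

theorem iteratedFDeriv_cellBump (w : (Fin s → Fin N) → Bool) (u : Fin s → Fin N) (k : ℕ)
    (z : Fin s → ℝ) : iteratedFDeriv ℝ k (cellBump w u) z =
      if w u then iteratedFDeriv ℝ k (unitBump s) (z - corner u) else 0 := by
  unfold cellBump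
  split_ifs
  · exact iteratedFDeriv_comp_sub k _ z
  · exact congrFun iteratedFDeriv_fun_zero z

theorem sub_corner_mem_of_iteratedFDeriv_cellBump_ne_zero {w : (Fin s → Fin N) → Bool}
    {u : Fin s → Fin N} {k : ℕ} {z : Fin s → ℝ} (h : iteratedFDeriv ℝ k (cellBump w u) z ≠ 0) :
    z - corner u ∈ Set.univ.pi fun _ => Set.Ioo 0 1 := by
  rw [iteratedFDeriv_cellBump, ne_eq, ite_eq_right_iff, Classical.not_imp] at h
  exact tsupport_unitBump_subset s (support_iteratedFDeriv_subset (𝕜 := ℝ) k h.2)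

theorem sub_corner_mem_of_cellBump_ne_zero {w : (Fin s → Fin N) → Bool} {u : Fin s → Fin N}
    {z : Fin s → ℝ} (h : cellBump w u z ≠ 0) :
    z - corner u ∈ Set.univ.pi fun _ => Set.Ioo 0 1 :=
  sub_corner_mem_of_iteratedFDeriv_cellBump_ne_zero (k := 0)
    (by rwa [← norm_ne_zero_iff, norm_iteratedFDeriv_zero, norm_ne_zero_iff])

/-- The sum of the bumps on the cells selected by `w`. -/
def bumpSum (w : (Fin s → Fin N) → Bool) (z : Fin s → ℝ) : ℝ := ∑ u, cellBump w u z

theorem contDiff_bumpSum (w : (Fin s → Fin N) → Bool) (k : ℕ) : ContDiff ℝ k (bumpSum w) :=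
  ContDiff.sum fun u _ => contDiff_cellBump w u k

theorem bumpSum_mem_Icc (w : (Fin s → Fin N) → Bool) (z : Fin s → ℝ) :
    bumpSum w z ∈ Set.Icc (0 : ℝ) 1 :=
  sum_mem_of_subsingleton_support (by simp)
    (fun _ hu _ hu' => eq_of_sub_corner_mem (sub_corner_mem_of_cellBump_ne_zero hu)
      (sub_corner_mem_of_cellBump_ne_zero hu')) fun u => cellBump_mem_Icc w u z

theorem bumpSum_of_mem (w : (Fin s → Fin N) → Bool) {u : Fin s → Fin N} {z : Fin s → ℝ}
    (hz : z - corner u ∈ cube s (1 / 4) (3 / 4)) : bumpSum w z = if w u then 1 else 0 := by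
  have hcell : z - corner u ∈ Set.univ.pi fun _ => Set.Ioo 0 1 :=
    tsupport_unitBump_subset s (subset_tsupport _ (by simp [unitBump_eq_one hz]))
  rw [bumpSum, Fintype.sum_eq_single u fun u' hu => of_not_not fun hne =>
    hu (eq_of_sub_corner_mem (sub_corner_mem_of_cellBump_ne_zero hne) hcell), cellBump,
    unitBump_eq_one hz]

theorem bumpSum_update (w : (Fin s → Fin N) → Bool) (u : Fin s → Fin N) (b : Bool)
    {z : Fin s → ℝ} (hz : z - corner u ∉ cube s 0 1) :
    bumpSum (Function.update w u b) z = bumpSum w z := by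
  have hzero (w' : (Fin s → Fin N) → Bool) : cellBump w' u z = 0 :=
    of_not_not fun hne => hz (mem_cube.2 fun a =>
      Set.Ioo_subset_Icc_self (sub_corner_mem_of_cellBump_ne_zero hne a trivial))
  refine Finset.sum_congr rfl fun u' _ => ?_
  rcases eq_or_ne u' u with rfl | hne
  · rw [hzero, hzero]
  · rw [cellBump, cellBump, Function.update_of_ne hne]

theorem norm_iteratedFDeriv_bumpSum_le (w : (Fin s → Fin N) → Bool) {k : ℕ} {C : ℝ}
    (hC : ∀ z, ‖iteratedFDeriv ℝ k (unitBump s) z‖ ≤ C) (z : Fin s → ℝ) :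
    ‖iteratedFDeriv ℝ k (bumpSum w) z‖ ≤ C := by
  have hC0 : 0 ≤ C := (norm_nonneg _).trans (hC 0)
  have hsum : iteratedFDeriv ℝ k (bumpSum w) z = ∑ u, iteratedFDeriv ℝ k (cellBump w u) z :=
    iteratedFDeriv_fun_sum_apply fun u _ => (contDiff_cellBump w u k).contDiffAt
  rw [hsum]
  refine sum_mem_of_subsingleton_support (S := {L | ‖L‖ ≤ C}) (by simpa using hC0)
    (fun u hu u' hu' => eq_of_sub_corner_mem
      (sub_corner_mem_of_iteratedFDeriv_cellBump_ne_zero hu)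
      (sub_corner_mem_of_iteratedFDeriv_cellBump_ne_zero hu')) fun u => ?_
  rw [Set.mem_ofPred_eq, iteratedFDeriv_cellBump]
  split_ifs
  · exact hC _
  · simpa using hC0

end Bumps

section GridFun

variable {s N : ℕ}

/-- The first `s` coordinates of a point of `ℝ^p`, in units of the mesh `1 / N`; missing
coordinates are `0`. -/
def scaledCoords (p s N : ℕ) : (Fin p → ℝ) →L[ℝ] (Fin s → ℝ) :=
  ContinuousLinearMap.pi fun a => (N : ℝ) • coord p a

theorem scaledCoords_apply (p s N : ℕ) (x : Fin p → ℝ) (a : Fin s) :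
    scaledCoords p s N x a = N * coord p a x := rfl

theorem norm_scaledCoords_le (p s N : ℕ) : ‖scaledCoords p s N‖ ≤ N := by
  refine ContinuousLinearMap.opNorm_le_bound _ (Nat.cast_nonneg N) fun x =>
    (pi_norm_le_iff_of_nonneg (by positivity)).2 fun a => ?_
  rw [scaledCoords_apply, norm_mul, Real.norm_natCast]
  exact mul_le_mul_of_nonneg_left (norm_coord_apply_le a x) (Nat.cast_nonneg N)

theorem scaledCoords_congr {p p' : ℕ} (N : ℕ) {x : Fin p → ℝ} {y : Fin p' → ℝ}
    (h : ∀ a < s, coord p a x = coord p' a y) : scaledCoords p s N x = scaledCoords p' s N y :=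
  funext fun a => by rw [scaledCoords_apply, scaledCoords_apply, h a a.2]

/-- The function on `ℝ^p` with bumps of height `N ^ (-β)` on the cells of mesh `1 / N` in the
first `s` coordinates that `w` selects. -/
def gridFun (p : ℕ) (β : ℝ) (w : (Fin s → Fin N) → Bool) (x : Fin p → ℝ) : ℝ :=
  (N : ℝ) ^ (-β) * bumpSum w (scaledCoords p s N x)

theorem gridFun_congr {p p' : ℕ} (β : ℝ) (w : (Fin s → Fin N) → Bool) {x : Fin p → ℝ}
    {y : Fin p' → ℝ} (h : ∀ a < s, coord p a x = coord p' a y) :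
    gridFun p β w x = gridFun p' β w y := by
  rw [gridFun, gridFun, scaledCoords_congr N h]

theorem gridFun_nonneg (p : ℕ) (β : ℝ) (w : (Fin s → Fin N) → Bool) (x : Fin p → ℝ) :
    0 ≤ gridFun p β w x :=
  mul_nonneg (by positivity) (bumpSum_mem_Icc w _).1

theorem gridFun_le (p : ℕ) (β : ℝ) (w : (Fin s → Fin N) → Bool) (x : Fin p → ℝ) :
    gridFun p β w x ≤ (N : ℝ) ^ (-β) :=
  mul_le_of_le_one_right (by positivity) (bumpSum_mem_Icc w _).2

theorem natCast_rpow_neg_le_one {β : ℝ} (hN : 1 ≤ N) (hβ : 0 ≤ β) : (N : ℝ) ^ (-β) ≤ 1 :=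
  Real.rpow_le_one_of_one_le_of_nonpos (by exact_mod_cast hN) (neg_nonpos.2 hβ)

theorem contDiff_gridFun (p : ℕ) (β : ℝ) (w : (Fin s → Fin N) → Bool) (k : ℕ) :
    ContDiff ℝ k (gridFun p β w) :=
  contDiff_const.mul ((contDiff_bumpSum w k).comp (scaledCoords p s N).contDiff)

theorem dependsOnAtMost_gridFun (p : ℕ) (l u β : ℝ) (w : (Fin s → Fin N) → Bool) :
    DependsOnAtMost p s l u (gridFun p β w) := by
  refine ⟨Finset.univ.filter fun i : Fin p => (i : ℕ) < s, by simp [Fin.card_filter_val_lt],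
    fun x _ y _ hxy => gridFun_congr β w fun a ha => ?_⟩
  by_cases hap : a < p
  · rw [coord_of_lt hap, coord_of_lt hap, hxy ⟨a, hap⟩ (by simpa using ha)]
  · simp [coord, hap]

theorem norm_iteratedFDeriv_gridFun_le (p : ℕ) (hN : 0 < N) (β : ℝ) (w : (Fin s → Fin N) → Bool)
    {k : ℕ} {C : ℝ} (hC : ∀ z, ‖iteratedFDeriv ℝ k (unitBump s) z‖ ≤ C) (x : Fin p → ℝ) :
    ‖iteratedFDeriv ℝ k (gridFun p β w) x‖ ≤ C * (N : ℝ) ^ ((k : ℝ) - β) := by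
  have hN0 : (0 : ℝ) < N := by exact_mod_cast hN
  have hC0 : 0 ≤ C := (norm_nonneg _).trans (hC 0)
  have hcomp : ‖iteratedFDeriv ℝ k (bumpSum w ∘ scaledCoords p s N) x‖ ≤ C * (N : ℝ) ^ k := by
    rw [(scaledCoords p s N).iteratedFDeriv_comp_right (contDiff_bumpSum w k) x le_rfl]
    refine (ContinuousMultilinearMap.norm_compContinuousLinearMap_le _ _).trans
      (mul_le_mul (norm_iteratedFDeriv_bumpSum_le w hC _) ?_ (by positivity) hC0)
    rw [Finset.prod_const, Finset.card_univ, Fintype.card_fin]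
    exact pow_le_pow_left₀ (norm_nonneg _) (norm_scaledCoords_le p s N) k
  have hsmul : gridFun p β w = (N : ℝ) ^ (-β) • (bumpSum w ∘ scaledCoords p s N) := rfl
  rw [hsmul, iteratedFDeriv_const_smul_apply
    ((contDiff_bumpSum w k).comp (scaledCoords p s N).contDiff).contDiffAt, norm_smul,
    Real.norm_of_nonneg (by positivity)]
  calc _ ≤ (N : ℝ) ^ (-β) * (C * (N : ℝ) ^ k) := by gcongr
    _ = C * (N : ℝ) ^ ((k : ℝ) - β) := by
        rw [sub_eq_add_neg, Real.rpow_add hN0, Real.rpow_natCast]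
        ring

theorem eventually_gridFun_mem_holderClass (p s : ℕ) {β : ℝ} (hβ : 0 ≤ β) :
    ∀ᶠ A in atTop, ∀ N : ℕ, 1 ≤ N → ∀ w : (Fin s → Fin N) → Bool,
      gridFun p β w ∈ holderClass p s 0 1 β A := by
  obtain ⟨C, hC⟩ := exists_norm_iteratedFDeriv_unitBump_le s (⌊β⌋₊ + 1)
  have hC0 : 0 ≤ C := (norm_nonneg _).trans (hC 0 (Nat.zero_le _) 0)
  filter_upwards [eventually_ge_atTop (holderCount p β * (2 * C))] with A hA N hN w
  refine ⟨dependsOnAtMost_gridFun p 0 1 β w, (contDiff_gridFun p β w _).contDiffOn, ?_⟩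
  exact (holderNorm_le_of_norm_iteratedFDeriv_le zero_lt_one hβ (by exact_mod_cast hN) hC0
    (contDiff_gridFun p β w _) fun k hk x _ =>
      norm_iteratedFDeriv_gridFun_le p hN β w (hC k hk) x).trans (ENNReal.ofReal_le_ofReal hA)

end GridFun

/-! ### Compositions carrying the bumps through one layer -/

section Layer

variable {q : ℕ} {d : Fin (q + 2) → ℕ} {s N : ℕ}

/-- The layer `k` of a composition whose only layer with bumps is the layer `i`: it copies
coordinates for `k < i`, is the grid function for `k = i`, and for `k > i` it is the power of the
first coordinate that costs the factor `min (β k) 1` in the effective smoothness. -/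
def layer (d : Fin (q + 2) → ℕ) (β : Fin (q + 1) → ℝ) (i : Fin (q + 1))
    (w : (Fin s → Fin N) → Bool) (k : Fin (q + 1)) (x : Fin (d k.castSucc) → ℝ) :
    Fin (d k.succ) → ℝ := fun j =>
  if k < i then coord _ j x else if k = i then gridFun _ (β i) w x else coord _ 0 x ^ min (β k) 1

theorem layer_of_lt (β : Fin (q + 1) → ℝ) {i k : Fin (q + 1)} (h : k < i)
    (w : (Fin s → Fin N) → Bool) (x : Fin (d k.castSucc) → ℝ) (j : Fin (d k.succ)) :
    layer d β i w k x j = coord _ j x := if_pos h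

theorem layer_self (β : Fin (q + 1) → ℝ) (i : Fin (q + 1)) (w : (Fin s → Fin N) → Bool)
    (x : Fin (d i.castSucc) → ℝ) (j : Fin (d i.succ)) :
    layer d β i w i x j = gridFun _ (β i) w x := by simp [layer]

theorem layer_of_gt (β : Fin (q + 1) → ℝ) {i k : Fin (q + 1)} (h : i < k)
    (w : (Fin s → Fin N) → Bool) (x : Fin (d k.castSucc) → ℝ) (j : Fin (d k.succ)) :
    layer d β i w k x j = coord _ 0 x ^ min (β k) 1 := by simp [layer, h.not_gt, h.ne']

theorem composite_succ (g : ∀ i : Fin (q + 1), (Fin (d i.castSucc) → ℝ) → (Fin (d i.succ) → ℝ))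
    (k : Fin (q + 1)) (x : Fin (d 0) → ℝ) :
    composite g k.succ x = g k (composite g k.castSucc x) := rfl

theorem coord_composite_layer {i : Fin (q + 1)} (hs : ∀ k ≤ i.castSucc, s ≤ d k)
    (β : Fin (q + 1) → ℝ) (w : (Fin s → Fin N) → Bool) (x : Fin (d 0) → ℝ) {k : Fin (q + 2)}
    (hk : k ≤ i.castSucc) {a : ℕ} (ha : a < s) :
    coord (d k) a (composite (layer d β i w) k x) = coord (d 0) a x := by
  induction k using Fin.induction with
  | zero => rfl
  | succ k ih =>
    have hki : k < i := Fin.castSucc_lt_castSucc_iff.1 ((Fin.castSucc_lt_succ).trans_le hk)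
    rw [composite_succ, coord_of_lt (ha.trans_le (hs _ hk)), layer_of_lt β hki,
      ih (Fin.castSucc_le_castSucc_iff.2 hki.le)]

/-- The exponent that the layers `l < k` with `l > i` apply to the grid function. -/
def tailExponent (β : Fin (q + 1) → ℝ) (i : Fin (q + 1)) (k : Fin (q + 2)) : ℝ :=
  ∏ l ∈ Finset.Ioi i with l.castSucc < k, min (β l) 1

theorem tailExponent_succ_self (β : Fin (q + 1) → ℝ) (i : Fin (q + 1)) :
    tailExponent β i i.succ = 1 := by
  rw [tailExponent, Finset.filter_eq_empty_iff.2, Finset.prod_empty]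
  intro l hl
  rw [Fin.castSucc_lt_succ_iff, not_le]
  exact Finset.mem_Ioi.1 hl

theorem tailExponent_succ (β : Fin (q + 1) → ℝ) {i k : Fin (q + 1)} (h : i < k) :
    tailExponent β i k.succ = tailExponent β i k.castSucc * min (β k) 1 := by
  have hinsert : (Finset.Ioi i).filter (fun l => l.castSucc < k.succ) =
      insert k ((Finset.Ioi i).filter fun l => l.castSucc < k.castSucc) := by
    ext l
    simp only [Finset.mem_filter, Finset.mem_Ioi, Finset.mem_insert, Fin.castSucc_lt_succ_iff,
      Fin.castSucc_lt_castSucc_iff]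
    grind
  rw [tailExponent, hinsert, Finset.prod_insert (by simp), mul_comm]
  rfl

theorem tailExponent_last (β : Fin (q + 1) → ℝ) (i : Fin (q + 1)) :
    tailExponent β i (Fin.last (q + 1)) = ∏ l ∈ Finset.Ioi i, min (β l) 1 := by
  rw [tailExponent, Finset.filter_true_of_mem fun l _ => Fin.castSucc_lt_last l]

theorem composite_layer {i : Fin (q + 1)} (hd : ∀ k : Fin (q + 1), 1 ≤ d k.castSucc)
    (hs : ∀ k ≤ i.castSucc, s ≤ d k) (β : Fin (q + 1) → ℝ) (w : (Fin s → Fin N) → Bool)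
    (x : Fin (d 0) → ℝ) {k : Fin (q + 2)} (hk : i.castSucc < k) (j : Fin (d k)) :
    composite (layer d β i w) k x j = gridFun (d 0) (β i) w x ^ tailExponent β i k := by
  induction k using Fin.induction with
  | zero => exact absurd hk (Fin.not_lt_zero _)
  | succ k ih =>
    rw [composite_succ]
    rcases (Fin.castSucc_lt_succ_iff.1 hk).eq_or_lt with rfl | hik
    · rw [layer_self, tailExponent_succ_self, Real.rpow_one]
      exact gridFun_congr _ w fun a ha => coord_composite_layer hs β w x le_rfl ha
    · rw [layer_of_gt β hik, coord_of_lt (hd k), ih (Fin.castSucc_lt_castSucc_iff.2 hik),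
        tailExponent_succ β hik, Real.rpow_mul (gridFun_nonneg _ _ w x)]

theorem layer_mapsTo {β : Fin (q + 1) → ℝ} (hβ : ∀ i, 0 ≤ β i) (hN : 1 ≤ N) (i : Fin (q + 1))
    (w : (Fin s → Fin N) → Bool) (k : Fin (q + 1)) :
    Set.MapsTo (layer d β i w k) (cube _ 0 1) (cube _ 0 1) := by
  refine fun x hx => mem_cube.2 fun j => ?_
  rcases lt_trichotomy k i with h | rfl | h
  · rw [layer_of_lt β h]
    exact coord_mem_Icc j hx
  · rw [layer_self]
    exact ⟨gridFun_nonneg _ _ w x,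
      (gridFun_le _ _ w x).trans (natCast_rpow_neg_le_one hN (hβ k))⟩
  · obtain ⟨h0, h1⟩ := coord_mem_Icc 0 hx
    rw [layer_of_gt β h]
    exact ⟨Real.rpow_nonneg h0 _, Real.rpow_le_one h0 h1 (le_min (hβ k) zero_le_one)⟩

theorem eventually_layer_mem_holderClass (d : Fin (q + 2) → ℕ) {t : Fin (q + 1) → ℕ}
    {β : Fin (q + 1) → ℝ} (ht : ∀ k, 1 ≤ t k) (hβ : ∀ k, 0 ≤ β k) (i : Fin (q + 1)) :
    ∀ᶠ A in atTop, ∀ N : ℕ, 1 ≤ N → ∀ (w : (Fin (t i) → Fin N) → Bool) (k : Fin (q + 1))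
      (j : Fin (d k.succ)), (fun x => layer d β i w k x j) ∈ holderClass _ (t k) 0 1 (β k) A := by
  filter_upwards [eventually_gridFun_mem_holderClass (d i.castSucc) (t i) (hβ i),
    eventually_all.2 fun k : Fin (q + 1) =>
      eventually_ge_atTop (holderCount (d k.castSucc) (β k) * 2 : ℝ)] with A hgrid hA N hN w k j
  rcases lt_trichotomy k i with h | rfl | h
  · simp only [layer_of_lt β h]
    exact coord_mem_holderClass (ht k) (hβ k) (hA k) j
  · simp only [layer_self]
    exact hgrid N hN w
  · simp only [layer_of_gt β h]
    exact coord_rpow_mem_holderClass (ht k) (hβ k) (hA k) 0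

end Layer

/-! ### The hypercube of mean functions -/

section BumpMean

variable {n s N : ℕ} {b B : ℝ}

/-- The mean function indexed by the vertex `w` of the hypercube: bumps of height `N ^ (-b)`,
raised to the power `B` that the outer layers of a composition apply to them. -/
def bumpMean (n : ℕ) (b B : ℝ) (w : (Fin s → Fin N) → Bool) : (Fin n → ℝ) → ℝ :=
  (cube n 0 1).indicator fun x => gridFun n b w x ^ B

theorem measurable_bumpMean (n : ℕ) (b B : ℝ) (w : (Fin s → Fin N) → Bool) :
    Measurable (bumpMean n b B w) :=
  ((contDiff_gridFun n b w 0).continuous.measurable.pow_const B).indicator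
    (measurableSet_cube n 0 1)

theorem bumpMean_mem_Icc (hB : 0 ≤ B) (w : (Fin s → Fin N) → Bool) (x : Fin n → ℝ) :
    bumpMean n b B w x ∈ Set.Icc 0 ((N : ℝ) ^ (-(b * B))) := by
  by_cases hx : x ∈ cube n 0 1
  · rw [bumpMean, Set.indicator_of_mem hx, ← neg_mul, Real.rpow_mul (Nat.cast_nonneg N)]
    have h0 := gridFun_nonneg n b w x
    exact ⟨Real.rpow_nonneg h0 _, Real.rpow_le_rpow h0 (gridFun_le n b w x) hB⟩
  · rw [bumpMean, Set.indicator_of_notMem hx]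
    exact ⟨le_rfl, by positivity⟩

theorem abs_bumpMean_le_one (hN : 1 ≤ N) (hb : 0 ≤ b) (hB : 0 ≤ B) (w : (Fin s → Fin N) → Bool)
    (x : Fin n → ℝ) : |bumpMean n b B w x| ≤ 1 := by
  obtain ⟨h0, h1⟩ := bumpMean_mem_Icc (b := b) hB w x
  rw [abs_of_nonneg h0]
  exact h1.trans (natCast_rpow_neg_le_one hN (mul_nonneg hb hB))

theorem bumpMean_mem_growthClass (hN : 1 ≤ N) (hb : 0 ≤ b) (hB : 0 ≤ B) {c : Fin (n + 1) → ℝ}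
    (hc0 : 1 ≤ c 0) (hc : ∀ i : Fin n, 0 ≤ c i.succ) (w : (Fin s → Fin N) → Bool) :
    bumpMean n b B w ∈ growthClass c :=
  ⟨measurable_bumpMean n b B w, fun x => (abs_bumpMean_le_one hN hb hB w x).trans <|
    hc0.trans <| le_add_of_nonneg_right <|
      Finset.sum_nonneg fun i _ => mul_nonneg (hc i) (abs_nonneg _)⟩

variable {q : ℕ} {d : Fin (q + 2) → ℕ} {t : Fin (q + 1) → ℕ} {β : Fin (q + 1) → ℝ}

theorem bumpMean_mem_compositionClass (hd : ∀ k : Fin (q + 1), 1 ≤ d k.castSucc)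
    (hβ : ∀ k, 0 ≤ β k) {i : Fin (q + 1)} (hs : ∀ k ≤ i.castSucc, s ≤ d k) (hN : 1 ≤ N) {A : ℝ}
    (hA : 1 ≤ A) {w : (Fin s → Fin N) → Bool}
    (hlayer : ∀ (k : Fin (q + 1)) (j : Fin (d k.succ)),
      (fun x => layer d β i w k x j) ∈ holderClass _ (t k) 0 1 (β k) A) :
    bumpMean (d 0) (β i) (∏ l ∈ Finset.Ioi i, min (β l) 1) w ∈ compositionClass q d t β A := by
  refine ⟨fun _ => 0, fun _ => 1, layer d β i w, rfl, rfl, fun _ => zero_lt_one, fun _ => ?_,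
    layer_mapsTo hβ hN i w, hlayer, fun x hx j => ?_⟩
  · rw [abs_zero, abs_one]
    exact ⟨zero_le_one.trans hA, hA⟩
  · rw [composite_layer hd hs β w x (Fin.castSucc_lt_last i), tailExponent_last, bumpMean,
      Set.indicator_of_mem hx]

theorem eventually_bumpMean_mem_meanClass (ht : ∀ k, 1 ≤ t k)
    (ht_le : ∀ k : Fin (q + 1), t k ≤ d k.castSucc) (hβ : ∀ k, 0 ≤ β k) {i : Fin (q + 1)}
    (hi : ∀ k ≤ i.castSucc, t i ≤ d k) :
    ∀ᶠ A in atTop, ∀ c : Fin (d 0 + 1) → ℝ, (∀ j : Fin (d 0), 0 ≤ c j.succ) → A ≤ c 0 →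
      ∀ N : ℕ, 1 ≤ N → ∀ w : (Fin (t i) → Fin N) → Bool,
        bumpMean (d 0) (β i) (∏ l ∈ Finset.Ioi i, min (β l) 1) w ∈ meanClass q d c t β A := by
  filter_upwards [eventually_layer_mem_holderClass d ht hβ i, eventually_ge_atTop (1 : ℝ)]
    with A hlayer hA c hc hAc N hN w
  exact ⟨bumpMean_mem_growthClass hN (hβ i)
      (Finset.prod_nonneg fun l _ => le_min (hβ l) zero_le_one) (hA.trans hAc) hc w,
    bumpMean_mem_compositionClass (fun k => (ht k).trans (ht_le k)) hβ hi hN hA (hlayer N hN w)⟩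

end BumpMean

/-! ### Grid boxes -/

section GridBox

variable {n s N : ℕ} {e f : ℝ}

/-- The points of the unit cube whose first `s` coordinates are in the grid cell `u`, at relative
positions in `[e, f]`. -/
def gridBox (n : ℕ) (e f : ℝ) (u : Fin s → Fin N) : Set (Fin n → ℝ) :=
  {x ∈ cube n 0 1 | scaledCoords n s N x - corner u ∈ cube s e f}

theorem gridBox_subset_cube (u : Fin s → Fin N) : gridBox n e f u ⊆ cube n 0 1 :=
  Set.sep_subset _ _

theorem pairwise_disjoint_gridBox (he : 0 < e) (hf : f < 1) :
    Pairwise (Function.onFun Disjoint fun u : Fin s → Fin N => gridBox n e f u) := by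
  have hsub : cube s e f ⊆ Set.univ.pi fun _ => Set.Ioo 0 1 := fun z hz a _ =>
    ⟨he.trans_le (mem_cube.1 hz a).1, (mem_cube.1 hz a).2.trans_lt hf⟩
  exact fun u u' hne => Set.disjoint_left.2 fun x hx hx' =>
    hne (eq_of_sub_corner_mem (hsub hx.2) (hsub hx'.2))

theorem mem_Icc_div_iff (he : 0 ≤ e) (hf : f ≤ 1) (k : Fin N) (x : ℝ) :
    x ∈ Set.Icc (((k : ℕ) + e) / N) (((k : ℕ) + f) / N) ↔
      (0 ≤ x ∧ x ≤ 1) ∧ e ≤ N * x - (k : ℕ) ∧ N * x - (k : ℕ) ≤ f := by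
  have hk : ((k : ℕ) : ℝ) + 1 ≤ N := by exact_mod_cast k.2
  have := Nat.cast_nonneg (α := ℝ) (k : ℕ)
  have hN : (0 : ℝ) < N := by linarith
  rw [Set.mem_Icc, div_le_iff₀ hN, le_div_iff₀ hN]
  refine ⟨fun h => ⟨⟨?_, ?_⟩, by linarith, by linarith⟩, fun h => ⟨by linarith, by linarith⟩⟩
  · exact nonneg_of_mul_nonneg_left (by linarith : 0 ≤ x * N) hN
  · exact le_of_mul_le_mul_right (by linarith : x * N ≤ 1 * N) hN

theorem gridBox_eq_pi (hs : s ≤ n) (he : 0 ≤ e) (hf : f ≤ 1) (u : Fin s → Fin N) :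
    gridBox n e f u = Set.univ.pi fun j : Fin n =>
      if h : (j : ℕ) < s then Set.Icc (((u ⟨j, h⟩ : ℕ) + e) / N) (((u ⟨j, h⟩ : ℕ) + f) / N)
      else Set.Icc 0 1 := by
  ext x
  simp only [gridBox, mem_cube, Set.mem_univ_pi, Pi.sub_apply, scaledCoords_apply, corner]
  refine ⟨fun ⟨hx, hxu⟩ j => ?_, fun h => ⟨fun j => ?_, fun a => ?_⟩⟩
  · split_ifs with hj
    · exact (mem_Icc_div_iff he hf (u ⟨j, hj⟩) (x j)).2
        ⟨hx j, by simpa only [coord_of_lt j.2] using hxu ⟨j, hj⟩⟩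
    · exact hx j
  · have hj := h j
    split_ifs at hj with hjs
    · exact ((mem_Icc_div_iff he hf (u ⟨j, hjs⟩) (x j)).1 hj).1
    · exact hj
  · have ha := h ⟨a, a.2.trans_le hs⟩
    simp only [a.2, dite_true] at ha
    rw [coord_of_lt (a.2.trans_le hs)]
    exact ((mem_Icc_div_iff he hf (u a) _).1 ha).2

theorem measurableSet_gridBox (u : Fin s → Fin N) : MeasurableSet (gridBox n e f u) :=
  (measurableSet_cube n 0 1).inter
    (((scaledCoords n s N).continuous.sub continuous_const).measurable (measurableSet_cube s e f))

theorem volume_gridBox (hs : s ≤ n) (he : 0 ≤ e) (hf : f ≤ 1) (u : Fin s → Fin N) :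
    volume (gridBox n e f u) = ENNReal.ofReal ((f - e) / N) ^ s := by
  have hside (j : Fin n) : volume (if h : (j : ℕ) < s
      then Set.Icc (((u ⟨j, h⟩ : ℕ) + e) / N) (((u ⟨j, h⟩ : ℕ) + f) / N) else Set.Icc (0 : ℝ) 1) =
      if (j : ℕ) < s then ENNReal.ofReal ((f - e) / N) else 1 := by
    split_ifs
    · rw [Real.volume_Icc]
      ring_nf
    · simp
  rw [gridBox_eq_pi hs he hf, volume_pi_pi, Finset.prod_congr rfl fun j _ => hside j,
    Finset.prod_ite, Finset.prod_const, Finset.prod_const_one, mul_one, Fin.card_filter_val_lt,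
    min_eq_right hs]

theorem sum_volume_gridBox (hs : s ≤ n) (he : 0 ≤ e) (hf : f ≤ 1) (hN : 0 < N) :
    ∑ u : Fin s → Fin N, volume (gridBox n e f u) = ENNReal.ofReal (f - e) ^ s := by
  simp only [volume_gridBox hs he hf, Finset.sum_const, Finset.card_univ, Fintype.card_fun,
    Fintype.card_fin, nsmul_eq_mul, Nat.cast_pow]
  rw [← mul_pow, ← ENNReal.ofReal_natCast, ← ENNReal.ofReal_mul (Nat.cast_nonneg N),
    mul_div_cancel₀ _ (by exact_mod_cast hN.ne')]

end GridBox

/-! ### The lower bound on a grid of mesh `1 / N` -/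

section LowerBound

variable {n s N : ℕ} {b B : ℝ}

/-- The permutation of the hypercube that flips the bit `u`. -/
def flipBit {ι : Type*} [DecidableEq ι] (u : ι) : Equiv.Perm (ι → Bool) :=
  Function.Involutive.toPerm (fun w => Function.update w u (!w u)) fun w => by simp

theorem flipBit_apply {ι : Type*} [DecidableEq ι] (u : ι) (w : ι → Bool) :
    flipBit u w = Function.update w u (!w u) := rfl

theorem natCast_rpow_neg_sq (N : ℕ) (x : ℝ) :
    ((N : ℝ) ^ (-x)) ^ 2 = (N : ℝ) ^ (-(2 * x)) := by
  rw [← Real.rpow_mul_natCast (Nat.cast_nonneg N)]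
  push_cast
  ring_nf

theorem edist_bumpMean_sq_le (hB : 0 ≤ B) (w w' : (Fin s → Fin N) → Bool) (x : Fin n → ℝ) :
    edist (bumpMean n b B w x) (bumpMean n b B w' x) ^ 2 ≤
      ENNReal.ofReal ((N : ℝ) ^ (-(2 * (b * B)))) := by
  have hdist := Real.dist_le_of_mem_Icc (bumpMean_mem_Icc (b := b) hB w x)
    (bumpMean_mem_Icc hB w' x)
  rw [sub_zero] at hdist
  rw [edist_dist, ← ENNReal.ofReal_pow dist_nonneg]
  exact ENNReal.ofReal_le_ofReal
    ((pow_le_pow_left₀ dist_nonneg hdist 2).trans_eq (natCast_rpow_neg_sq N _))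

theorem bumpMean_of_mem_gridBox (hB : B ≠ 0) (w : (Fin s → Fin N) → Bool) {u : Fin s → Fin N}
    {x : Fin n → ℝ} (hx : x ∈ gridBox n (1 / 4) (3 / 4) u) :
    bumpMean n b B w x = if w u then (N : ℝ) ^ (-(b * B)) else 0 := by
  rw [bumpMean, Set.indicator_of_mem hx.1, gridFun, bumpSum_of_mem w hx.2]
  split_ifs
  · rw [mul_one, ← Real.rpow_mul (Nat.cast_nonneg N), neg_mul]
  · rw [mul_zero, Real.zero_rpow hB]

theorem edist_bumpMean_flipBit_sq (hB : B ≠ 0) (w : (Fin s → Fin N) → Bool) {u : Fin s → Fin N}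
    {x : Fin n → ℝ} (hx : x ∈ gridBox n (1 / 4) (3 / 4) u) :
    edist (bumpMean n b B w x) (bumpMean n b B (flipBit u w) x) ^ 2 =
      ENNReal.ofReal ((N : ℝ) ^ (-(2 * (b * B)))) := by
  have hdist : dist (bumpMean n b B w x) (bumpMean n b B (flipBit u w) x) =
      (N : ℝ) ^ (-(b * B)) := by
    rw [bumpMean_of_mem_gridBox hB _ hx, bumpMean_of_mem_gridBox hB _ hx, Real.dist_eq]
    have hpos : 0 ≤ (N : ℝ) ^ (-(b * B)) := by positivity
    cases h : w u <;> simp [flipBit_apply, h, abs_of_nonneg hpos]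
  rw [edist_dist, ← ENNReal.ofReal_pow dist_nonneg, hdist, natCast_rpow_neg_sq]

theorem bumpMean_flipBit_of_notMem (w : (Fin s → Fin N) → Bool) {u : Fin s → Fin N}
    {x : Fin n → ℝ} (hx : x ∉ gridBox n 0 1 u) :
    bumpMean n b B (flipBit u w) x = bumpMean n b B w x := by
  by_cases hxc : x ∈ cube n 0 1
  · rw [bumpMean, bumpMean, Set.indicator_of_mem hxc, Set.indicator_of_mem hxc, gridFun, gridFun]
    exact congrArg (fun z => ((N : ℝ) ^ (-b) * z) ^ B)
      (bumpSum_update w u _ fun hu => hx ⟨hxc, hu⟩)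
  · rw [bumpMean, bumpMean, Set.indicator_of_notMem hxc, Set.indicator_of_notMem hxc]

theorem lintegral_edist_bumpMean_flipBit_sq_le (hs : s ≤ n) (hB : 0 ≤ B)
    (w : (Fin s → Fin N) → Bool) (u : Fin s → Fin N) :
    ∫⁻ x, edist (bumpMean n b B w x) (bumpMean n b B (flipBit u w) x) ^ 2 ≤
      ENNReal.ofReal ((N : ℝ) ^ (-(2 * (b * B))) * (1 / N) ^ s) := by
  calc _ ≤ ∫⁻ x, (gridBox n 0 1 u).indicator
          (fun _ => ENNReal.ofReal ((N : ℝ) ^ (-(2 * (b * B))))) x := by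
        refine lintegral_mono fun x => ?_
        by_cases hx : x ∈ gridBox n 0 1 u
        · rw [Set.indicator_of_mem hx]
          exact edist_bumpMean_sq_le hB _ _ x
        · simp [bumpMean_flipBit_of_notMem w hx]
    _ = _ := by
        rw [lintegral_indicator_const (measurableSet_gridBox u),
          volume_gridBox hs le_rfl le_rfl, sub_zero, ENNReal.ofReal_mul (by positivity),
          ENNReal.ofReal_pow (by positivity)]

theorem le_minimaxRisk_of_bumpMean_mem (hs : s ≤ n) (hN : 1 ≤ N) (hb : 0 ≤ b) (hB : 0 < B)
    (ν : Measure (Fin n → ℝ)) [IsProbabilityMeasure ν] {M : Set ((Fin n → ℝ) → ℝ)}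
    (hM : ∀ w : (Fin s → Fin N) → Bool, bumpMean n b B w ∈ M) {T : ℕ} (hT : 0 < T)
    (hnT : 2 * n ≤ T) (hclose : n * (N : ℝ) ^ (-(2 * (b * B))) +
      T * ((N : ℝ) ^ (-(2 * (b * B))) * (1 / N) ^ s) ≤ 2) :
    1 / 2 * gaussianPDF 0 1 (1 + 1) ^ n * (ENNReal.ofReal ((N : ℝ) ^ (-(2 * (b * B)))) / 4 / 2 *
      ENNReal.ofReal (1 / 2) ^ s) ≤ minimaxRisk ν M T := by
  have hsum : ∑ u : Fin s → Fin N, volume (gridBox n (1 / 4) (3 / 4) u) =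
      ENNReal.ofReal (1 / 2) ^ s := by
    rw [sum_volume_gridBox hs (by norm_num) (by norm_num) hN]
    norm_num
  rw [← hsum]
  refine le_minimaxRisk_of_perm hT hnT hM (measurable_bumpMean n b B)
    (abs_bumpMean_le_one hN hb hB.le) flipBit measurableSet_gridBox gridBox_subset_cube
    (pairwise_disjoint_gridBox (by norm_num) (by norm_num))
    (fun w u x hx => (edist_bumpMean_flipBit_sq hB.ne' w hx).ge)
    (fun w u x => edist_bumpMean_sq_le hB.le w _ x) fun w u => ?_
  calc _ ≤ n * ENNReal.ofReal ((N : ℝ) ^ (-(2 * (b * B)))) +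
          T * ENNReal.ofReal ((N : ℝ) ^ (-(2 * (b * B))) * (1 / N) ^ s) := by
        gcongr
        exact lintegral_edist_bumpMean_flipBit_sq_le hs hB.le w u
    _ = ENNReal.ofReal (n * (N : ℝ) ^ (-(2 * (b * B))) +
          T * ((N : ℝ) ^ (-(2 * (b * B))) * (1 / N) ^ s)) := by
        rw [ENNReal.ofReal_add (by positivity) (by positivity),
          ENNReal.ofReal_mul (Nat.cast_nonneg n), ENNReal.ofReal_mul (Nat.cast_nonneg T),
          ENNReal.ofReal_natCast, ENNReal.ofReal_natCast]
    _ ≤ 2 := by simpa using ENNReal.ofReal_le_ofReal hclose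

end LowerBound

/-! ### The rate -/

section Rate

/-- The number of grid cells per coordinate for which `T` observations just fail to detect the
bumps: the mesh is `T ^ (-1 / (2 e + s))`, where `s` is the dimension and `e` the smoothness. -/
def gridSize (e : ℝ) (s T : ℕ) : ℕ := ⌈(T : ℝ) ^ (1 / (2 * e + s))⌉₊

variable {e : ℝ} {s T : ℕ}

theorem one_le_rpow_gridSize (he : 0 ≤ e) (hT : 1 ≤ T) : 1 ≤ (T : ℝ) ^ (1 / (2 * e + s)) :=
  Real.one_le_rpow (by exact_mod_cast hT) (by positivity)

theorem one_le_gridSize (he : 0 ≤ e) (hT : 1 ≤ T) : 1 ≤ gridSize e s T :=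
  Nat.one_le_ceil_iff.2 (zero_lt_one.trans_le (one_le_rpow_gridSize he hT))

theorem rpow_neg_div_eq (e : ℝ) (s T : ℕ) :
    (T : ℝ) ^ (-(2 * e / (2 * e + s))) = ((T : ℝ) ^ (1 / (2 * e + s))) ^ (-(2 * e)) := by
  rw [← Real.rpow_mul (Nat.cast_nonneg T)]
  ring_nf

theorem gridSize_rpow_neg_le (he : 0 ≤ e) (hT : 1 ≤ T) :
    (gridSize e s T : ℝ) ^ (-(2 * e)) ≤ (T : ℝ) ^ (-(2 * e / (2 * e + s))) := by
  rw [rpow_neg_div_eq]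
  exact Real.rpow_le_rpow_of_nonpos (zero_lt_one.trans_le (one_le_rpow_gridSize he hT))
    (Nat.le_ceil _) (by linarith)

theorem le_gridSize_rpow_neg (he : 0 ≤ e) (hT : 1 ≤ T) :
    (2 : ℝ) ^ (-(2 * e)) * (T : ℝ) ^ (-(2 * e / (2 * e + s))) ≤
      (gridSize e s T : ℝ) ^ (-(2 * e)) := by
  have hy := one_le_rpow_gridSize (s := s) he hT
  rw [rpow_neg_div_eq, ← Real.mul_rpow zero_le_two (by linarith)]
  exact Real.rpow_le_rpow_of_nonpos (by exact_mod_cast one_le_gridSize he hT)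
    (Nat.ceil_le_two_mul (by linarith)) (by linarith)

theorem mul_gridSize_rpow_neg_le_one (he : 0 < e) (hT : 1 ≤ T) :
    T * ((gridSize e s T : ℝ) ^ (-(2 * e)) * (1 / gridSize e s T) ^ s) ≤ 1 := by
  have hN : (0 : ℝ) < gridSize e s T := by exact_mod_cast one_le_gridSize he.le hT
  have hTle : (T : ℝ) ≤ (gridSize e s T : ℝ) ^ (2 * e + s) := by
    calc (T : ℝ) = ((T : ℝ) ^ (1 / (2 * e + s))) ^ (2 * e + s) := by
          rw [← Real.rpow_mul (Nat.cast_nonneg T), one_div_mul_cancel (by positivity),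
            Real.rpow_one]
      _ ≤ _ := Real.rpow_le_rpow (by positivity) (Nat.le_ceil _) (by positivity)
  have hpow : (gridSize e s T : ℝ) ^ (-(2 * e)) * (1 / gridSize e s T) ^ s =
      ((gridSize e s T : ℝ) ^ (2 * e + s))⁻¹ := by
    rw [Real.rpow_add hN, Real.rpow_natCast, Real.rpow_neg hN.le, one_div, inv_pow, mul_inv]
  rw [hpow, ← div_eq_mul_inv]
  exact div_le_one_of_le₀ hTle (by positivity)

theorem eventually_mul_gridSize_rpow_neg_add_le_two (n : ℕ) (he : 0 < e) :
    ∀ᶠ T : ℕ in atTop, n * (gridSize e s T : ℝ) ^ (-(2 * e)) +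
      T * ((gridSize e s T : ℝ) ^ (-(2 * e)) * (1 / gridSize e s T) ^ s) ≤ 2 := by
  have hlim : Tendsto (fun T : ℕ => (n : ℝ) * (T : ℝ) ^ (-(2 * e / (2 * e + s))))
      atTop (nhds 0) := by
    simpa using ((tendsto_rpow_neg_atTop (by positivity)).comp
      tendsto_natCast_atTop_atTop).const_mul (n : ℝ)
  filter_upwards [hlim.eventually_le_const zero_lt_one, eventually_ge_atTop 1] with T hT hT1
  have hmesh := mul_le_mul_of_nonneg_left (gridSize_rpow_neg_le (s := s) he.le hT1)
    (Nat.cast_nonneg (α := ℝ) n)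
  linarith [mul_gridSize_rpow_neg_le_one (s := s) he hT1]

theorem exists_eventually_mul_rpow_le_minimaxRisk {n : ℕ} {b B : ℝ} (hs : s ≤ n) (hb : 0 < b)
    (hB : 0 < B) :
    ∃ C : ℝ≥0∞, 0 < C ∧ ∀ (ν : Measure (Fin n → ℝ)) [IsProbabilityMeasure ν]
      (M : Set ((Fin n → ℝ) → ℝ)),
      (∀ N : ℕ, 1 ≤ N → ∀ w : (Fin s → Fin N) → Bool, bumpMean n b B w ∈ M) →
      ∀ᶠ T : ℕ in atTop, C * ENNReal.ofReal ((T : ℝ) ^ (-(2 * (b * B) / (2 * (b * B) + s)))) ≤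
        minimaxRisk ν M T := by
  have he : 0 < b * B := mul_pos hb hB
  refine ⟨1 / 2 * gaussianPDF 0 1 (1 + 1) ^ n *
    (ENNReal.ofReal (2 ^ (-(2 * (b * B)))) / 4 / 2 * ENNReal.ofReal (1 / 2) ^ s), ?_,
    fun ν _ M hM => ?_⟩
  · have hpdf := gaussianPDF_pos 0 one_ne_zero (1 + 1)
    have htwo : 0 < ENNReal.ofReal ((2 : ℝ) ^ (-(2 * (b * B)))) :=
      ENNReal.ofReal_pos.2 (by positivity)
    simp [pos_iff_ne_zero, ENNReal.div_eq_zero_iff, hpdf.ne', htwo.ne']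
  filter_upwards [eventually_mul_gridSize_rpow_neg_add_le_two n he, eventually_ge_atTop 1,
    eventually_ge_atTop (2 * n)] with T hclose hT hnT
  have hN := one_le_gridSize (s := s) he.le hT
  refine le_trans ?_
    (le_minimaxRisk_of_bumpMean_mem hs hN hb.le hB ν (hM _ hN) hT hnT hclose)
  calc _ = 1 / 2 * gaussianPDF 0 1 (1 + 1) ^ n * (ENNReal.ofReal (2 ^ (-(2 * (b * B))) *
          (T : ℝ) ^ (-(2 * (b * B) / (2 * (b * B) + s)))) / 4 / 2 *
          ENNReal.ofReal (1 / 2) ^ s) := by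
        rw [ENNReal.ofReal_mul (by positivity)]
        simp only [div_eq_mul_inv]
        ring
    _ ≤ _ := by
        gcongr
        exact le_gridSize_rpow_neg he.le hT

variable {q : ℕ}

theorem exists_rate_eq_rpow (t : Fin (q + 1) → ℕ) (β : Fin (q + 1) → ℝ) :
    ∃ i, ∀ T : ℕ, 1 ≤ T → rate t β T =
      (T : ℝ) ^ (-(2 * effSmoothness β i / (2 * effSmoothness β i + t i))) := by
  obtain ⟨i, hi⟩ := Finite.exists_min
    fun i => 2 * effSmoothness β i / (2 * effSmoothness β i + (t i : ℝ))
  refine ⟨i, fun T hT => le_antisymm (Finset.sup'_le _ _ fun j _ =>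
    Real.rpow_le_rpow_of_exponent_le (by exact_mod_cast hT) (neg_le_neg (hi j))) ?_⟩
  exact Finset.le_sup' (fun i => (T : ℝ) ^
    (-(2 * effSmoothness β i / (2 * effSmoothness β i + (t i : ℝ))))) (Finset.mem_univ i)

theorem le_width_of_le_castSucc {d : Fin (q + 2) → ℕ} {t : Fin (q + 1) → ℕ}
    (ht_le : ∀ i : Fin (q + 1), t i ≤ d i.castSucc)
    (ht_min : ∀ i j : Fin (q + 1), i < j → t j ≤ d i.castSucc) (i : Fin (q + 1))
    {k : Fin (q + 2)} (hk : k ≤ i.castSucc) : t i ≤ d k := by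
  obtain ⟨k, rfl⟩ := Fin.exists_castSucc_eq.2 (hk.trans_lt (Fin.castSucc_lt_last i)).ne
  rcases (Fin.castSucc_le_castSucc_iff.1 hk).lt_or_eq with h | rfl
  exacts [ht_min k i h, ht_le k]

theorem liminf_inv_mul_pos_of_eventually_mul_le {r R : ℕ → ℝ≥0∞} {C : ℝ≥0∞} (hC : 0 < C)
    (hr : ∀ᶠ T in atTop, r T ≠ 0 ∧ r T ≠ ⊤) (h : ∀ᶠ T in atTop, C * r T ≤ R T) :
    0 < liminf (fun T => (r T)⁻¹ * R T) atTop := by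
  refine hC.trans_le (le_liminf_of_le (by isBoundedDefault) ?_)
  filter_upwards [hr, h] with T hrT hT
  rw [mul_comm, ← div_eq_mul_inv]
  exact (ENNReal.le_div_iff_mul_le (Or.inl hrT.1) (Or.inl hrT.2)).2 hT

end Rate

end NonlinearAR

end

theorem mainTheorem3_general (q : ℕ) (d : Fin (q + 2) → ℕ) (t : Fin (q + 1) → ℕ)
    (β : Fin (q + 1) → ℝ) (ht_pos : ∀ i, 1 ≤ t i)
    (ht_le : ∀ i : Fin (q + 1), t i ≤ d i.castSucc) (hβ : ∀ i, 0 < β i)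
    (ht_min : ∀ i j : Fin (q + 1), i < j → t j ≤ d i.castSucc) :
    ∃ A₀ : ℝ, 0 < A₀ ∧ ∀ A : ℝ, A₀ ≤ A →
      ∀ c : Fin (d 0 + 1) → ℝ, (∀ i : Fin (d 0), 0 ≤ c i.succ) → A ≤ c 0 →
      ∀ (ν : Measure (Fin (d 0) → ℝ)) [IsProbabilityMeasure ν],
        0 < liminf (fun T : ℕ => (ENNReal.ofReal (rate t β T))⁻¹ *
          minimaxRisk ν (meanClass q d c t β A) T) atTop := by
  obtain ⟨i, hrate⟩ := exists_rate_eq_rpow t β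
  have hwidth : ∀ k ≤ i.castSucc, t i ≤ d k := fun k => le_width_of_le_castSucc ht_le ht_min i
  obtain ⟨A₀, hmem⟩ := eventually_atTop.1
    (eventually_bumpMean_mem_meanClass ht_pos ht_le (fun k => (hβ k).le) hwidth)
  obtain ⟨C, hC, hrisk⟩ := exists_eventually_mul_rpow_le_minimaxRisk
    (hwidth 0 (Fin.zero_le _)) (hβ i)
    (Finset.prod_pos fun l (_ : l ∈ Finset.Ioi i) => lt_min (hβ l) one_pos)
  refine ⟨max A₀ 1, by positivity, fun A hA c hc hAc ν _ => ?_⟩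
  have hclass := hmem A ((le_max_left _ _).trans hA) c hc hAc
  refine liminf_inv_mul_pos_of_eventually_mul_le hC ?_ ?_
  · filter_upwards [eventually_ge_atTop 1] with T hT
    rw [hrate T hT]
    exact ⟨(ENNReal.ofReal_pos.2 (Real.rpow_pos_of_pos (by exact_mod_cast hT) _)).ne',
      ENNReal.ofReal_ne_top⟩
  · filter_upwards [hrisk ν _ hclass, eventually_ge_atTop 1] with T hT hT1
    rw [hrate T hT1]
    exact hT

theorem mainTheorem3 (q : ℕ) (d : Fin (q + 2) → ℕ) (t : Fin (q + 1) → ℕ) (β : Fin (q + 1) → ℝ)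
    (hd : d (Fin.last (q + 1)) = 1)
    (ht_pos : ∀ i, 1 ≤ t i)
    (ht_le : ∀ i : Fin (q + 1), t i ≤ d i.castSucc)
    (hβ : ∀ i, 0 < β i)
    (ht_min : ∀ i j : Fin (q + 1), i < j → t j ≤ d i.castSucc) :
    ∃ A₀ : ℝ, 0 < A₀ ∧ ∀ A : ℝ, A₀ ≤ A →
      ∀ c : Fin (d 0 + 1) → ℝ, (∀ i, 0 < c i) → ∑ i : Fin (d 0), c i.succ < 1 → A ≤ c 0 →
      ∀ (ν : Measure (Fin (d 0) → ℝ)) [IsProbabilityMeasure ν],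
        Integrable (fun x => ‖WithLp.toLp 2 x‖) ν →
        0 < liminf (fun T : ℕ => (ENNReal.ofReal (rate t β T))⁻¹ *
          minimaxRisk ν (meanClass q d c t β A) T) atTop := by
  obtain ⟨A₀, hA₀, h⟩ := mainTheorem3_general q d t β ht_pos ht_le hβ ht_min
  exact ⟨A₀, hA₀, fun A hA c hc _ hAc ν _ _ => h A hA c (fun i => (hc i.succ).le) hAc ν⟩
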